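/- Let $G$ be a group with centre $Z(G)$. The commuting graph $\Gamma(G)$ is the simple graph with vertex set $G\setminus Z(G)$ in which two distinct vertices $x,y$ are joined by an edge if and only if $xy=yx$. For $k\in\mathbb{N}$, call $G$ strong $k$-star free if $\Gamma(G)$ has no subgraph (induced or not) isomorphic to the star $K_{1,k}$. Let $C_n$ be the cyclic group of order $n$, $D_{2n}$ the dihedral group of order $2n$, $Q_8$ the quaternion group of order $8$, and $\mathrm{GA}(1,5)$ the group of affine bijections of the line over $\mathbb{F}_5$ (of order $20$). A group $G$ is finite, non-abelian and strong $4$-star free if and only if it is isomorphic to one of the following sixteen groups: $$S_3,\quad A_4,\quad A_5,\quad D_8,\quad D_{10},\quad \mathrm{GA}(1,5),\quad Q_8,\quad D_{12},\quad C_3\rtimes C_4,\quad \mathrm{SL}(2,3),$$ and the following six groups of order $16$ with centre of order $4$: $$(C_4\times C_2)\rtimes_{\sigma} C_2,\quad C_4\rtimes C_4,\quad C_8\rtimes C_2,\quad D_8\times C_2,\quad Q_8\times C_2,\quad (C_4\times C_2)\rtimes_{\tau} C_2.$$ Here in $C_3\rtimes C_4$ and $C_4\rtimes C_4$ a generator of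 the right-hand factor acts by inversion; in $C_8\rtimes C_2$ the generator of $C_2$ acts by $x\mapsto x^5$; and, writing $C_4\times C_2=\langle a\rangle\times\langle b\rangle$, the generator of the right-hand $C_2$ acts by $\sigma\colon a\mapsto ab,\ b\mapsto b$ in the first of the six groups and by $\tau\colon a\mapsto a,\ b\mapsto a^2b$ in the last. -/

import Mathlib

/-- The commuting graph `Γ(G)`: the vertices are the non-central elements of `G`, and two distinct
vertices are adjacent iff they commute. -/
def commutingGraph (G : Type*) [Group G] : SimpleGraph {x : G // x ∉ Subgroup.center G} where
  Adj x y := x ≠ y ∧ (x : G) * (y : G) = (y : G) * (x : G)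
  symm := ⟨fun _ _ h => ⟨h.1.symm, h.2.symm⟩⟩
  loopless := ⟨fun _ h => h.1 rfl⟩

/-- `G` is strong `k`-star free: the star `K_{1,k}` is not a (not necessarily induced) subgraph of
the commuting graph of `G`. -/
def StrongStarFree (k : ℕ) (G : Type*) [Group G] : Prop :=
  (completeBipartiteGraph (Fin 1) (Fin k)).Free (commutingGraph G)

/-- The cyclic group of order `n` (for `n ≠ 0`), written multiplicatively. -/
abbrev Cyc (n : ℕ) : Type := Multiplicative (ZMod n)

/-- The action of the cyclic group of order `n` on `N` in which the standard generator acts as the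
automorphism `f`, where `f ^ n = 1`. -/
def cyclicAction {N : Type*} [Group N] (n : ℕ) [NeZero n] (f : MulAut N) (hf : f ^ n = 1) :
    Cyc n →* MulAut N where
  toFun g := f ^ (Multiplicative.toAdd g).val
  map_one' := by simp
  map_mul' a b := by
    rw [toAdd_mul, ZMod.val_add, ← pow_add]
    conv_rhs => rw [← Nat.mod_add_div ((Multiplicative.toAdd a).val + (Multiplicative.toAdd b).val) n,
      pow_add, pow_mul, hf, one_pow, mul_one]

/-- The inversion automorphism of the cyclic group of order `n`. -/
def invAut (n : ℕ) : MulAut (Cyc n) := MulEquiv.inv (Cyc n)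

/-- The automorphism `x ↦ x ^ 5` of the cyclic group of order `8`. -/
def powFiveAut : MulAut (Cyc 8) where
  toFun x := x ^ 5
  invFun x := x ^ 5
  left_inv := by unfold Function.LeftInverse; decide
  right_inv := by unfold Function.RightInverse Function.LeftInverse; decide
  map_mul' := by intro a b; exact mul_pow a b 5

/-- The automorphism of `C₄ × C₂ = ⟨a⟩ × ⟨b⟩` with `a ↦ a * b` and `b ↦ b`. -/
def shearAut : MulAut (Cyc 4 × Cyc 2) where
  toFun p := (p.1, p.2 * Multiplicative.ofAdd 1 ^ (Multiplicative.toAdd p.1).val)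
  invFun p := (p.1, p.2 * Multiplicative.ofAdd 1 ^ (Multiplicative.toAdd p.1).val)
  left_inv := by unfold Function.LeftInverse; decide
  right_inv := by unfold Function.RightInverse Function.LeftInverse; decide
  map_mul' := by decide

/-- The automorphism of `C₄ × C₂ = ⟨a⟩ × ⟨b⟩` with `a ↦ a` and `b ↦ a ^ 2 * b`. -/
def twistAut : MulAut (Cyc 4 × Cyc 2) where
  toFun p := (p.1 * Multiplicative.ofAdd 2 ^ (Multiplicative.toAdd p.2).val, p.2)
  invFun p := (p.1 * Multiplicative.ofAdd 2 ^ (Multiplicative.toAdd p.2).val, p.2)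
  left_inv := by unfold Function.LeftInverse; decide
  right_inv := by unfold Function.RightInverse Function.LeftInverse; decide
  map_mul' := by decide

theorem invAut_sq (n : ℕ) : invAut n ^ 2 = 1 := by
  rw [pow_two]
  exact MulEquiv.ext fun x => inv_inv x

theorem invAut_pow_four (n : ℕ) : invAut n ^ 4 = 1 := by
  rw [show (4 : ℕ) = 2 * 2 from rfl, pow_mul, invAut_sq, one_pow]

theorem powFiveAut_sq : powFiveAut ^ 2 = 1 := by
  rw [pow_two]
  exact MulEquiv.ext powFiveAut.left_inv

theorem shearAut_sq : shearAut ^ 2 = 1 := by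
  rw [pow_two]
  exact MulEquiv.ext shearAut.left_inv

theorem twistAut_sq : twistAut ^ 2 = 1 := by
  rw [pow_two]
  exact MulEquiv.ext twistAut.left_inv

/-- `C₃ ⋊ C₄`, the generator of `C₄` acting by inversion (the dicyclic group of order `12`). -/
abbrev C3sdC4 : Type := Cyc 3 ⋊[cyclicAction 4 (invAut 3) (invAut_pow_four 3)] Cyc 4

/-- `C₄ ⋊ C₄`, the generator of the second factor acting by inversion. -/
abbrev C4sdC4 : Type := Cyc 4 ⋊[cyclicAction 4 (invAut 4) (invAut_pow_four 4)] Cyc 4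

/-- `C₈ ⋊ C₂`, the generator of `C₂` acting by `x ↦ x ^ 5` (the modular group of order `16`). -/
abbrev C8sdC2 : Type := Cyc 8 ⋊[cyclicAction 2 powFiveAut powFiveAut_sq] Cyc 2

/-- `(C₄ × C₂) ⋊ C₂`, the generator of the right-hand `C₂` acting by `a ↦ a * b`, `b ↦ b`. -/
abbrev C4C2sdC2shear : Type := (Cyc 4 × Cyc 2) ⋊[cyclicAction 2 shearAut shearAut_sq] Cyc 2

/-- `(C₄ × C₂) ⋊ C₂`, the generator of the right-hand `C₂` acting by `a ↦ a`, `b ↦ a ^ 2 * b`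
(the Pauli group). -/
abbrev C4C2sdC2twist : Type := (Cyc 4 × Cyc 2) ⋊[cyclicAction 2 twistAut twistAut_sq] Cyc 2

/-- `GA(1,5)`, the general affine group of the line over the field with five elements. -/
abbrev GA15 : Type := ZMod 5 ≃ᵃ[ZMod 5] ZMod 5

/-! A star centred at a noncentral `x` needs four further noncentral elements commuting with `x`, so
for finite `G` star-freeness is the inequality |C(x)| ≤ |Z| + 4 for all noncentral `x`
(`strongStarFree_four_iff`). Since |Z| is a proper divisor of |C(x)|, this forces |Z| ≤ 4 and leaves
a short list of values for |C(x)| (`SmallCentralizers.card_cases`). The elements with centralizer of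
order k are a union of classes of size |G|/k, so the class equation divided by |G| is a sum of unit
fractions and leaves only finitely many orders of `G`. The groups are then identified according to
|Z|.

|Z| = 1: |G| divides 60. A nontrivial class has at least |G|/5 elements, so small subgroups contain
no nontrivial normal subgroup, and the action on cosets of a subgroup of order 2, 3 or 12 gives S₃,
A₄ or A₅. In orders 10 and 20 an element of order five generates its own centralizer, and the
elements acting on it give D₁₀ and GA(1,5). In order 15 the elements of order three would form one
class, making some element conjugate to its inverse in a group of odd order.

|Z| = 2: |G| is 8, 12 or 24. The first two orders have a noncentral cyclic subgroup of index two. In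
order 24 the Sylow 2-subgroup consists of the centre and a single class of six elements of order
four, and an element of order three moves these as it does in SL(2,3)
(`nonempty_mulEquiv_Q8sdC3_of_center`).

|Z| = 3: |G| = 18, and an abelian subgroup of order nine contradicts |C(x)| = 6.

|Z| = 4: every noncentral centralizer has order 8, so squares and commutators are central and the
commutator is bilinear. This excludes order 32 (`not_card_eq_thirtyTwo`). In order 16 a noncommuting
pair together with the centre generates, and normalizing the squares of such a pair yields the six
groups.

Conversely, most listed groups are so small that any proper subgroup meets the bound. For A₄ and A₅
the element orders suffice, and GA(1,5) and SL(2,3) are checked by computation in semidirect product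
models. -/

/-- Every noncentral element has a centralizer with at most four elements outside the centre. -/
def SmallCentralizers (G : Type*) [Group G] : Prop :=
  ∀ x : G, x ∉ Subgroup.center G →
    Nat.card (Subgroup.centralizer {x}) ≤ Nat.card (Subgroup.center G) + 4

/-! ### Star-freeness as a bound on centralizer orders -/

/-- An isomorphism of groups induces an isomorphism of commuting graphs. -/
def commutingGraphIso {G H : Type*} [Group G] [Group H] (e : G ≃* H) :
    commutingGraph G ≃g commutingGraph H where
  toEquiv := e.toEquiv.subtypeEquiv fun x => by
    simp only [Subgroup.mem_center_iff, not_iff_not]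
    constructor
    · intro h y
      have := congrArg e (h (e.symm y))
      simpa using this
    · intro h y
      apply e.injective
      simpa using h (e y)
  map_rel_iff' := by
    rintro ⟨x, hx⟩ ⟨y, hy⟩
    simp [commutingGraph, ← map_mul]

theorem StrongStarFree.congr {G H : Type*} [Group G] [Group H] {k : ℕ} (e : G ≃* H)
    (h : StrongStarFree k H) : StrongStarFree k G :=
  (SimpleGraph.free_congr_right (commutingGraphIso e)).mpr h

theorem mem_centralizer_singleton {G : Type*} [Group G] {x y : G} :
    y ∈ Subgroup.centralizer {x} ↔ y * x = x * y := by
  rw [Subgroup.mem_centralizer_singleton_iff]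

theorem card_centralizer_diff {G : Type*} [Group G] [Finite G] (x : G) :
    Nat.card (Subgroup.centralizer {x}) = Nat.card (Subgroup.center G) +
      Set.ncard {y : G | y * x = x * y ∧ y ∉ Subgroup.center G} := by
  have h1 : Nat.card (Subgroup.centralizer {x}) =
      Set.ncard ((Subgroup.centralizer {x} : Subgroup G) : Set G) := rfl
  have h2 : Nat.card (Subgroup.center G) = Set.ncard ((Subgroup.center G : Subgroup G) : Set G) :=
    rfl
  rw [h1, h2, ← Set.ncard_union_eq]
  · congr 1
    ext y
    simp only [Set.mem_union, SetLike.mem_coe, mem_centralizer_singleton, Set.mem_ofPred_eq]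
    by_cases hy : y ∈ Subgroup.center G
    · simp [hy, Subgroup.mem_center_iff.mp hy x]
    · simp [hy]
  · rw [Set.disjoint_left]
    intro y hy h
    exact h.2 hy

theorem strongStarFree_four_iff {G : Type*} [Group G] [Finite G] :
    StrongStarFree 4 G ↔ SmallCentralizers G := by
  constructor
  · intro h x hx
    by_contra! hlt
    rw [card_centralizer_diff] at hlt
    apply h
    set S := {y : G | y * x = x * y ∧ y ∉ Subgroup.center G} with hS
    have hxS : x ∈ S := ⟨rfl, hx⟩
    -- `S` contains the star's centre `x` itself, so failure of the bound means |S| ≥ 5 and exactly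
    -- the needed four leaves remain.
    have h4 : 4 ≤ (S \ {x}).ncard := by
      have := Set.ncard_sdiff_singleton_add_one hxS (Set.toFinite S)
      omega
    have : Nat.card (Fin 4) ≤ Nat.card ↥(S \ {x}) := by
      rw [Nat.card_fin]; exact h4
    have : Fintype (S \ {x} : Set G) := Fintype.ofFinite _
    obtain ⟨f⟩ : Nonempty (Fin 4 ↪ (S \ {x} : Set G)) := by
      apply Function.Embedding.nonempty_of_card_le
      rw [← Nat.card_eq_fintype_card, ← Nat.card_eq_fintype_card]
      assumption
    refine ⟨⟨⟨fun v => Sum.elim (fun _ => ⟨x, hx⟩) (fun i => ⟨f i, (f i).2.1.2⟩) v, ?_⟩, ?_⟩⟩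
    · rintro (a | a) (b | b) hab
      · simp at hab
      · refine ⟨fun he => (f b).2.2 ?_, (f b).2.1.1.symm⟩
        exact (congrArg Subtype.val he).symm
      · refine ⟨fun he => (f a).2.2 ?_, (f a).2.1.1⟩
        exact congrArg Subtype.val he
      · simp at hab
    · rintro (a | a) (b | b) hab
      · exact congrArg _ (Subsingleton.elim _ _)
      · exact ((f b).2.2 (congrArg Subtype.val hab).symm).elim
      · exact ((f a).2.2 (congrArg Subtype.val hab)).elim
      · have hv : (f a : G) = f b :=
          congrArg (fun w : {x : G // x ∉ Subgroup.center G} => (w : G)) hab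
        exact congrArg _ (f.injective (Subtype.ext hv))
  · rintro h ⟨f⟩
    set x := f (Sum.inl 0) with hx
    have h1 := h x x.2
    rw [card_centralizer_diff] at h1
    set S := {y : G | y * x = x * y ∧ y ∉ Subgroup.center G} with hS
    have hinj : Function.Injective (fun v => (f v : G)) :=
      Subtype.val_injective.comp f.injective
    -- The centre and the four leaves are five distinct elements of `S`, one more than the bound
    -- allows.
    have hsub : Set.range (fun v => (f v : G)) ⊆ S := by
      rintro _ ⟨v, rfl⟩
      refine ⟨?_, (f v).2⟩
      rcases v with a | a
      · rw [Subsingleton.elim a 0]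
      · have : (completeBipartiteGraph (Fin 1) (Fin 4)).Adj (Sum.inr a) (Sum.inl 0) := by simp
        exact (f.toHom.map_adj this).2
    have := Set.ncard_le_ncard hsub (Set.toFinite S)
    rw [← Set.image_univ, Set.ncard_image_of_injective _ hinj, Set.ncard_univ] at this
    simp at this
    omega

/-! ### Homomorphisms defined by generators and relations -/

/-- The homomorphism from the cyclic group of order `n` mapping the standard generator to `a`. -/
def cycHom {G : Type*} [Group G] (n : ℕ) [NeZero n] (a : G) (ha : a ^ n = 1) : Cyc n →* G where
  toFun g := a ^ (Multiplicative.toAdd g).val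
  map_one' := by simp
  map_mul' x y := by
    rw [toAdd_mul, ZMod.val_add, ← pow_add]
    conv_rhs => rw [← Nat.mod_add_div ((Multiplicative.toAdd x).val + (Multiplicative.toAdd y).val) n,
      pow_add, pow_mul, ha, one_pow, mul_one]

theorem conj_pow_of_conj {G : Type*} [Group G] {a b c : G} (h : b * a * b⁻¹ = c) (k : ℕ) :
    b * a ^ k * b⁻¹ = c ^ k := by
  rw [← h, conj_pow]

/-- The homomorphism from a semidirect product with a cyclic group, determined by its values on the
normal factor and on the standard generator. -/
def cyclicLift {G N : Type*} [Group G] [Group N] {n : ℕ} [NeZero n] {f : MulAut N} {hf : f ^ n = 1}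
    (φ : N →* G) (c : G) (hc : c ^ n = 1) (h : ∀ x, φ (f x) = c * φ x * c⁻¹) :
    N ⋊[cyclicAction n f hf] Cyc n →* G :=
  SemidirectProduct.lift φ (cycHom n c hc) fun g => by
    have key : ∀ (k : ℕ) (x : N), φ ((f ^ k) x) = c ^ k * φ x * (c ^ k)⁻¹ := by
      intro k
      induction k with
      | zero => simp
      | succ k ih =>
        intro x
        rw [pow_succ', MulAut.mul_apply, h, ih]
        group
    ext x
    exact key _ x

/-- The homomorphism from a dihedral group determined by the dihedral relations. -/
def dihedralLift {G : Type*} [Group G] (n : ℕ) [NeZero n] (a b : G) (ha : a ^ n = 1)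
    (hb : b ^ 2 = 1) (hab : b * a * b⁻¹ = a⁻¹) : DihedralGroup n →* G := by
  -- Moving `b` past a power of `a` inverts the power; this one rule settles every case of
  -- multiplicativity.
  have hinv : ∀ i : ZMod n, cycHom n a ha (.ofAdd i) * b = b * cycHom n a ha (.ofAdd (-i)) := by
    intro i
    have h1 : b * cycHom n a ha (.ofAdd i) * b⁻¹ = cycHom n a ha (.ofAdd (-i)) := by
      rw [ofAdd_neg, map_inv]
      change b * a ^ _ * b⁻¹ = _
      rw [conj_pow_of_conj hab, inv_pow]
      rfl
    have hb' : b⁻¹ = b := by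
      rw [inv_eq_iff_mul_eq_one, ← pow_two, hb]
    rw [← h1, hb', mul_assoc, ← mul_assoc b b, ← pow_two, hb, one_mul]
  exact MonoidHom.mk' (fun x => match x with
    | .r i => cycHom n a ha (.ofAdd i)
    | .sr i => b * cycHom n a ha (.ofAdd i)) (by
    rintro (i | i) (j | j)
    · simp [ofAdd_add]
    · simp only [DihedralGroup.r_mul_sr]
      rw [← mul_assoc, hinv, mul_assoc, ← map_mul, ← ofAdd_add, neg_add_eq_sub]
    · simp [ofAdd_add, mul_assoc]
    · simp only [DihedralGroup.sr_mul_sr]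
      rw [mul_assoc, ← mul_assoc (cycHom n a ha _) b, hinv, mul_assoc, ← map_mul, ← ofAdd_add,
        neg_add_eq_sub, ← mul_assoc, ← pow_two, hb, one_mul])

/-- The homomorphism from a generalized quaternion group determined by its relations. -/
def quaternionLift {G : Type*} [Group G] (n : ℕ) [NeZero (2 * n)] (a b : G)
    (ha : a ^ (2 * n) = 1) (hb : b ^ 2 = a ^ n) (hab : b * a * b⁻¹ = a⁻¹) :
    QuaternionGroup n →* G := by
  have hinv : ∀ i : ZMod (2 * n), cycHom (2 * n) a ha (.ofAdd i) * b =
      b * cycHom (2 * n) a ha (.ofAdd (-i)) := by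
    intro i
    have h1 : b * cycHom (2 * n) a ha (.ofAdd (-i)) * b⁻¹ = cycHom (2 * n) a ha (.ofAdd i) := by
      conv_rhs => rw [← neg_neg i, ofAdd_neg, map_inv]
      change b * a ^ _ * b⁻¹ = _
      rw [conj_pow_of_conj hab, inv_pow]
      rfl
    rw [← h1]
    group
  have hn : cycHom (2 * n) a ha (.ofAdd (n : ZMod (2 * n))) = a ^ n := by
    change a ^ ZMod.val (n : ZMod (2 * n)) = a ^ n
    have := NeZero.ne (2 * n)
    rw [ZMod.val_natCast_of_lt (by omega)]
  exact MonoidHom.mk' (fun x => match x with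
    | .a i => cycHom (2 * n) a ha (.ofAdd i)
    | .xa i => b * cycHom (2 * n) a ha (.ofAdd i)) (by
    rintro (i | i) (j | j)
    · simp [ofAdd_add]
    · simp only [QuaternionGroup.a_mul_xa]
      rw [← mul_assoc, hinv, mul_assoc, ← map_mul, ← ofAdd_add, neg_add_eq_sub]
    · simp [ofAdd_add, mul_assoc]
    · simp only [QuaternionGroup.xa_mul_xa]
      rw [mul_assoc, ← mul_assoc (cycHom (2 * n) a ha _) b, hinv, mul_assoc, ← map_mul,
        ← ofAdd_add, neg_add_eq_sub, ← mul_assoc, ← pow_two, hb, ← hn, ← map_mul, ← ofAdd_add,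
        add_sub_assoc])

theorem nonempty_mulEquiv_of_range_eq_top {G H : Type*} [Group G] [Group H] [Finite H]
    (f : H →* G) (hf : f.range = ⊤) (hc : Nat.card H = Nat.card G) : Nonempty (G ≃* H) :=
  ⟨(MulEquiv.ofBijective f ((Nat.bijective_iff_surjective_and_card f).mpr
    ⟨MonoidHom.range_eq_top.mp hf, hc⟩)).symm⟩

/-! ### Conjugacy classes sorted by centralizer order -/

theorem card_conjClass_mul_card_centralizer {G : Type*} [Group G] [Finite G] (x : G) :
    Set.ncard {y : G | IsConj x y} * Nat.card (Subgroup.centralizer {x}) = Nat.card G := by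
  have h := (MulAction.stabilizer (ConjAct G) x).index_mul_card
  rw [MulAction.index_stabilizer] at h
  have h1 := Subgroup.nat_card_centralizer_nat_card_stabilizer x
  rw [h1]
  change _ = Nat.card (ConjAct G)
  rw [← h]
  congr 2
  ext y
  rw [ConjAct.mem_orbit_conjAct, Set.mem_ofPred_eq, isConj_comm]

theorem card_centralizer_of_isConj {G : Type*} [Group G] [Finite G] {x y : G} (h : IsConj x y) :
    Nat.card (Subgroup.centralizer {x}) = Nat.card (Subgroup.centralizer {y}) := by
  have h1 := card_conjClass_mul_card_centralizer x
  have h2 := card_conjClass_mul_card_centralizer y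
  have : {z : G | IsConj x z} = {z : G | IsConj y z} := by
    ext z
    exact ⟨fun hz => h.symm.trans hz, fun hz => h.trans hz⟩
  rw [← h2, this] at h1
  refine Nat.eq_of_mul_eq_mul_left ?_ h1
  rw [Set.ncard_pos]
  exact ⟨y, IsConj.refl y⟩

/-- The number of elements whose centralizer has order `k`. -/
noncomputable def centralizerCount (G : Type*) [Group G] (k : ℕ) : ℕ :=
  Set.ncard {x : G | Nat.card (Subgroup.centralizer {x}) = k}

/-- The elements counted form a union of conjugacy classes, and each class, multiplied by `k`,
contributes exactly |G|. -/
theorem card_dvd_centralizerCount_mul (G : Type*) [Group G] [Finite G] (k : ℕ) :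
    Nat.card G ∣ centralizerCount G k * k := by
  classical
  have := Fintype.ofFinite G
  set S : Finset G := Finset.univ.filter fun x => Nat.card (Subgroup.centralizer {x}) = k with hS
  have h1 : centralizerCount G k = S.card := by
    rw [centralizerCount, ← Set.ncard_coe_finset]
    simp [hS]
  rw [h1, Finset.card_eq_sum_card_image ConjClasses.mk S, Finset.sum_mul]
  apply Finset.dvd_sum
  intro c hc
  obtain ⟨x, hx, rfl⟩ := Finset.mem_image.mp hc
  have hx' : Nat.card (Subgroup.centralizer {x}) = k := by simpa [hS] using hx
  rw [← card_conjClass_mul_card_centralizer x, hx']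
  apply dvd_of_eq
  congr 1
  rw [← Set.ncard_coe_finset]
  congr 1
  ext y
  simp only [hS, Set.mem_ofPred_eq, Finset.coe_filter, Finset.mem_filter, Finset.mem_univ, true_and,
    ConjClasses.mk_eq_mk_iff_isConj]
  constructor
  · intro h
    exact ⟨by rw [← card_centralizer_of_isConj h, hx'], h.symm⟩
  · intro h
    exact h.2.symm

theorem mem_center_iff_card_centralizer {G : Type*} [Group G] [Finite G] {x : G} :
    x ∈ Subgroup.center G ↔ Nat.card (Subgroup.centralizer {x}) = Nat.card G := by
  rw [Subgroup.card_eq_iff_eq_top, Subgroup.eq_top_iff', Subgroup.mem_center_iff]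
  simp [mem_centralizer_singleton]

/-- The class equation with classes grouped by centralizer order. The hypothesis `hG` keeps central
elements, whose centralizer is all of `G`, from being counted twice. -/
theorem card_eq_center_add_sum (G : Type*) [Group G] [Finite G] (K : Finset ℕ)
    (hK : ∀ x : G, x ∉ Subgroup.center G → Nat.card (Subgroup.centralizer {x}) ∈ K)
    (hG : Nat.card G ∉ K) :
    Nat.card G = Nat.card (Subgroup.center G) + ∑ k ∈ K, centralizerCount G k := by
  classical
  have := Fintype.ofFinite G
  have h1 : (Finset.univ.filter fun x : G => x ∉ Subgroup.center G).card =
      ∑ k ∈ K, centralizerCount G k := by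
    rw [Finset.card_eq_sum_card_fiberwise (f := fun x => Nat.card (Subgroup.centralizer {x}))
      (t := K)]
    · apply Finset.sum_congr rfl
      intro k hk
      rw [centralizerCount, ← Set.ncard_coe_finset]
      congr 1
      ext x
      simp only [Finset.filter_filter, Finset.coe_filter, Finset.mem_univ, true_and,
        Set.mem_ofPred_eq, mem_center_iff_card_centralizer]
      constructor
      · exact fun h => h.2
      · rintro rfl
        exact ⟨fun h => hG (h ▸ hk), rfl⟩
    · intro x hx
      exact hK x (by simpa using hx)
  rw [← h1, Nat.card_eq_fintype_card, Nat.card_eq_fintype_card, Fintype.card_subtype,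
    Finset.card_filter_add_card_filter_not, Finset.card_univ]

/-! ### Criteria for the centralizer bound, and concrete models -/

/-- A proper subgroup has at most half the elements, and half of 2|Z| + 9 rounds down to |Z| + 4. -/
theorem smallCentralizers_of_card_le {G : Type*} [Group G] [Finite G]
    (h : Nat.card G ≤ 2 * Nat.card (Subgroup.center G) + 9) : SmallCentralizers G := by
  intro x hx
  rw [mem_center_iff_card_centralizer] at hx
  obtain ⟨k, hk⟩ := Subgroup.card_subgroup_dvd_card (Subgroup.centralizer {x})
  have hpos : 0 < Nat.card G := Nat.card_pos
  rcases k with - | - | k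
  · omega
  · omega
  · nlinarith

theorem card_le_card_center {G : Type*} [Group G] [Finite G] (S : Finset G)
    (h : ∀ z ∈ S, ∀ g : G, g * z = z * g) : S.card ≤ Nat.card (Subgroup.center G) := by
  rw [← Set.ncard_coe_finset]
  exact Set.ncard_le_ncard (fun z hz => Subgroup.mem_center_iff.mpr (h z hz)) (Set.toFinite _)

/-- A form suited to evaluation: `S` is an explicit list of central elements, so only a lower bound
for the centre has to be supplied. -/
theorem smallCentralizers_of_card_filter_le {G : Type*} [Group G] [Fintype G] [DecidableEq G]
    (c : ℕ) (S : Finset G) (hS : ∀ z ∈ S, ∀ g : G, g * z = z * g) (hc : c ≤ S.card + 4)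
    (h : ∀ x : G, (∀ y, y * x = x * y) ∨ (Finset.univ.filter fun y => y * x = x * y).card ≤ c) :
    SmallCentralizers G := by
  intro x hx
  have h2 := card_le_card_center S hS
  rcases h x with h | h
  · exact (hx (Subgroup.mem_center_iff.mpr h)).elim
  · have : Nat.card (Subgroup.centralizer {x}) = (Finset.univ.filter fun y => y * x = x * y).card := by
      rw [← Set.ncard_coe_finset]
      change Set.ncard _ = _
      congr 1
      ext y
      simp [mem_centralizer_singleton]
    omega

/-- The squaring automorphism of the cyclic group of order five. -/
def squareAut : MulAut (Cyc 5) where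
  toFun x := x ^ 2
  invFun x := x ^ 3
  left_inv := by unfold Function.LeftInverse; decide
  right_inv := by unfold Function.RightInverse Function.LeftInverse; decide
  map_mul' a b := mul_pow a b 2

theorem squareAut_pow_four : squareAut ^ 4 = 1 := by
  ext x
  revert x
  decide

/-- The Frobenius group of order twenty. -/
abbrev C5sdC4 : Type := Cyc 5 ⋊[cyclicAction 4 squareAut squareAut_pow_four] Cyc 4

/-- An automorphism of order three of the quaternion group. -/
def quaternionAut : MulAut (QuaternionGroup 2) :=
  let f := quaternionLift 2 (.xa 0 : QuaternionGroup 2) (.xa 3) (by decide) (by decide) (by decide)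
  { f with
    -- The automorphism has order three, so its inverse is its square.
    invFun := fun x => f (f x)
    left_inv := by unfold Function.LeftInverse; decide
    right_inv := by unfold Function.RightInverse Function.LeftInverse; decide }

theorem quaternionAut_pow_three : quaternionAut ^ 3 = 1 := by
  ext x
  revert x
  decide

/-- `Q₈ ⋊ C₃`, the binary tetrahedral group. -/
abbrev Q8sdC3 : Type := QuaternionGroup 2 ⋊[cyclicAction 3 quaternionAut quaternionAut_pow_three] Cyc 3

instance {N H : Type*} [Group N] [Group H] [Fintype N] [Fintype H] (φ : H →* MulAut N) :
    Fintype (N ⋊[φ] H) := Fintype.ofEquiv _ SemidirectProduct.equivProd.symm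

theorem smallCentralizers_C5sdC4 : SmallCentralizers C5sdC4 :=
  smallCentralizers_of_card_filter_le 5 {1} (by simp) (by simp) (by decide +kernel)

theorem smallCentralizers_Q8sdC3 : SmallCentralizers Q8sdC3 :=
  smallCentralizers_of_card_filter_le 6 {1, .inl (.a 2)} (by decide +kernel) (by decide)
   (by decide +kernel)

/-- If `x` has prime order p, an element of another prime order q in its centralizer would give an
element of order pq ≥ 6. So the centralizer has prime power order dividing 60, hence at most 5. -/
theorem smallCentralizers_of_orderOf {G : Type*} [Group G] [Finite G] (hG : Nat.card G ∣ 60)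
    (h : ∀ x : G, x ^ 2 = 1 ∨ x ^ 3 = 1 ∨ x ^ 5 = 1) : SmallCentralizers G := by
  intro x hx
  have hx1 : x ≠ 1 := fun h => hx (h ▸ Subgroup.one_mem _)
  have hz : 0 < Nat.card (Subgroup.center G) := Nat.card_pos
  by_contra! hlt
  have hdvd : Nat.card (Subgroup.centralizer {x}) ∣ 60 :=
    (Subgroup.card_subgroup_dvd_card _).trans hG
  set c := Nat.card (Subgroup.centralizer {x}) with hc
  have key : ∀ p q : ℕ, p.Prime → q.Prime → p ≠ q → p ≤ 5 → q ≤ 5 → orderOf x = p → ¬ q ∣ c := by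
    intro p q hp hq hpq hp5 hq5 hxp hqc
    have := Fact.mk hq
    obtain ⟨⟨y, hy⟩, hyq⟩ := exists_prime_orderOf_dvd_card' q (hc ▸ hqc)
    rw [Subgroup.orderOf_mk] at hyq
    have hcomm : Commute y x := mem_centralizer_singleton.mp hy
    have hco : (orderOf y).Coprime (orderOf x) := by
      rw [hyq, hxp]
      exact (Nat.coprime_primes hq hp).mpr hpq.symm
    have ho := hcomm.orderOf_mul_eq_mul_orderOf_of_coprime hco
    rw [hyq, hxp] at ho
    have h2 := hp.two_le
    have h3 := hq.two_le
    have h4 : 6 ≤ q * p := by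
      rcases lt_or_gt_of_ne hpq with h | h <;> nlinarith
    rcases h (y * x) with h | h | h <;> have h5 := orderOf_le_of_pow_eq_one (by norm_num) h <;> omega
  have hne : orderOf x ≠ 1 := by rwa [ne_eq, orderOf_eq_one_iff]
  have hord : orderOf x = 2 ∨ orderOf x = 3 ∨ orderOf x = 5 := by
    rcases h x with h | h | h <;> have h5 := orderOf_dvd_of_pow_eq_one h
    · exact Or.inl (((Nat.dvd_prime Nat.prime_two).mp h5).resolve_left hne)
    · exact Or.inr (Or.inl (((Nat.dvd_prime Nat.prime_three).mp h5).resolve_left hne))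
    · exact Or.inr (Or.inr (((Nat.dvd_prime Nat.prime_five).mp h5).resolve_left hne))
  have hc' : 5 < c := by omega
  have hmem : c ∈ Nat.divisors 60 := by simp [hdvd]
  -- A divisor of 60 above 5 has at least two of the primes 2, 3, 5 as factors; each conjunct
  -- supplies one different from the order of `x`.
  have hfin : ∀ n ∈ Nat.divisors 60, 5 < n →
      (2 ∣ n ∨ 3 ∣ n) ∧ (2 ∣ n ∨ 5 ∣ n) ∧ (3 ∣ n ∨ 5 ∣ n) := by decide
  obtain ⟨h1, h2, h3⟩ := hfin c hmem hc'
  rcases hord with ho | ho | ho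
  · rcases h3 with h | h
    · exact key 2 3 (by norm_num) (by norm_num) (by norm_num) (by norm_num) (by norm_num) ho h
    · exact key 2 5 (by norm_num) (by norm_num) (by norm_num) (by norm_num) (by norm_num) ho h
  · rcases h2 with h | h
    · exact key 3 2 (by norm_num) (by norm_num) (by norm_num) (by norm_num) (by norm_num) ho h
    · exact key 3 5 (by norm_num) (by norm_num) (by norm_num) (by norm_num) (by norm_num) ho h
  · rcases h1 with h | h
    · exact key 5 2 (by norm_num) (by norm_num) (by norm_num) (by norm_num) (by norm_num) ho h
    · exact key 5 3 (by norm_num) (by norm_num) (by norm_num) (by norm_num) (by norm_num) ho h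

theorem card_alternatingGroup_fin (n : ℕ) (hn : 2 ≤ n) :
    2 * Nat.card (alternatingGroup (Fin n)) = n.factorial := by
  have : Nontrivial (Fin n) := Fin.nontrivial_iff_two_le.mpr hn
  rw [Nat.card_eq_fintype_card, two_mul_card_alternatingGroup, Fintype.card_perm, Fintype.card_fin]

theorem smallCentralizers_alternatingGroup_four : SmallCentralizers (alternatingGroup (Fin 4)) := by
  have hc := card_alternatingGroup_fin 4 (by norm_num)
  have h : ∀ x : Equiv.Perm (Fin 4), Equiv.Perm.sign x = 1 → x ^ 2 = 1 ∨ x ^ 3 = 1 ∨ x ^ 5 = 1 := by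
    decide +kernel
  refine smallCentralizers_of_orderOf ⟨5, ?_⟩ fun x => ?_
  · simp [Nat.factorial] at hc ⊢
    omega
  · simpa [Subtype.ext_iff] using h x x.2

theorem smallCentralizers_alternatingGroup_five : SmallCentralizers (alternatingGroup (Fin 5)) := by
  have hc := card_alternatingGroup_fin 5 (by norm_num)
  have h : ∀ x : Equiv.Perm (Fin 5), Equiv.Perm.sign x = 1 → x ^ 2 = 1 ∨ x ^ 3 = 1 ∨ x ^ 5 = 1 := by
    decide +kernel
  refine smallCentralizers_of_orderOf ⟨1, ?_⟩ fun x => ?_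
  · simp [Nat.factorial] at hc ⊢
    omega
  · simpa [Subtype.ext_iff] using h x x.2

theorem card_specialLinearGroup_two_three :
    Nat.card (Matrix.SpecialLinearGroup (Fin 2) (ZMod 3)) = 24 := by
  rw [Nat.card_eq_fintype_card]
  decide +kernel

theorem cycHom_ofAdd_one {G : Type*} [Group G] (n : ℕ) [NeZero n] (a : G) (ha : a ^ n = 1) :
    cycHom n a ha (.ofAdd 1) = a := by
  change a ^ (1 : ZMod n).val = a
  rw [ZMod.val_one_eq_one_mod]
  have := Nat.mod_add_div 1 n
  conv_rhs => rw [← pow_one a, ← this, pow_add, pow_mul, ha, one_pow, mul_one]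

theorem mem_range_cyclicLift {G N : Type*} [Group G] [Group N] {n : ℕ} [NeZero n] {f : MulAut N}
    {hf : f ^ n = 1} (φ : N →* G) (c : G) (hc : c ^ n = 1) (h : ∀ x, φ (f x) = c * φ x * c⁻¹) :
    (∀ x, φ x ∈ (cyclicLift (hf := hf) φ c hc h).range) ∧
      c ∈ (cyclicLift (hf := hf) φ c hc h).range := by
  refine ⟨fun x => ⟨.inl x, SemidirectProduct.lift_inl _ _ _ _⟩, ⟨.inr (.ofAdd 1), ?_⟩⟩
  exact (SemidirectProduct.lift_inr _ _ _ _).trans (cycHom_ofAdd_one n c hc)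

theorem mem_range_dihedralLift {G : Type*} [Group G] (n : ℕ) [NeZero n] (a b : G) (ha : a ^ n = 1)
    (hb : b ^ 2 = 1) (hab : b * a * b⁻¹ = a⁻¹) :
    a ∈ (dihedralLift n a b ha hb hab).range ∧ b ∈ (dihedralLift n a b ha hb hab).range :=
  ⟨⟨.r 1, cycHom_ofAdd_one n a ha⟩, ⟨.sr 0, by
    change b * cycHom n a ha 1 = b
    simp⟩⟩

theorem quaternionLift_a_one {G : Type*} [Group G] (n : ℕ) [NeZero (2 * n)] (a b : G)
    (ha : a ^ (2 * n) = 1) (hb : b ^ 2 = a ^ n) (hab : b * a * b⁻¹ = a⁻¹) :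
    quaternionLift n a b ha hb hab (.a 1) = a := cycHom_ofAdd_one _ a ha

theorem quaternionLift_xa_zero {G : Type*} [Group G] (n : ℕ) [NeZero (2 * n)] (a b : G)
    (ha : a ^ (2 * n) = 1) (hb : b ^ 2 = a ^ n) (hab : b * a * b⁻¹ = a⁻¹) :
    quaternionLift n a b ha hb hab (.xa 0) = b := by
  change b * cycHom (2 * n) a ha 1 = b
  simp

theorem mem_range_quaternionLift {G : Type*} [Group G] (n : ℕ) [NeZero (2 * n)] (a b : G)
    (ha : a ^ (2 * n) = 1) (hb : b ^ 2 = a ^ n) (hab : b * a * b⁻¹ = a⁻¹) :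
    a ∈ (quaternionLift n a b ha hb hab).range ∧ b ∈ (quaternionLift n a b ha hb hab).range :=
  ⟨⟨.a 1, quaternionLift_a_one ..⟩, ⟨.xa 0, quaternionLift_xa_zero ..⟩⟩

theorem quaternionGroup_two_hom_ext {G : Type*} [Group G] {f g : QuaternionGroup 2 →* G}
    (ha : f (.a 1) = g (.a 1)) (hx : f (.xa 0) = g (.xa 0)) : f = g := by
  have h1 : ∀ i : ZMod 4, (QuaternionGroup.a i : QuaternionGroup 2) = (.a 1) ^ i.val := by decide
  have h2 : ∀ i : ZMod 4, (QuaternionGroup.xa i : QuaternionGroup 2) = .xa 0 * (.a 1) ^ i.val := by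
    decide
  ext (i | i)
  · rw [h1, map_pow, map_pow, ha]
  · rw [h2, map_mul, map_mul, map_pow, map_pow, ha, hx]

/-- Both sides are homomorphisms in `q`, so the two generators suffice; there the claim is `hhx` and
`hhy`. -/
theorem quaternionLift_quaternionAut {G : Type*} [Group G] {x y h : G} (hx : x ^ 4 = 1)
    (hyx : y ^ 2 = x ^ 2) (hxy : y * x * y⁻¹ = x⁻¹) (hhx : h * x * h⁻¹ = y)
    (hhy : h * y * h⁻¹ = x * y) (q : QuaternionGroup 2) :
    quaternionLift 2 x y hx hyx hxy (quaternionAut q) =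
      h * quaternionLift 2 x y hx hyx hxy q * h⁻¹ := by
  have key : (quaternionLift 2 x y hx hyx hxy).comp quaternionAut.toMonoidHom =
      (MulAut.conj h).toMonoidHom.comp (quaternionLift 2 x y hx hyx hxy) := by
    have ha : quaternionAut (.a 1) = .xa 0 := by decide
    have hb : quaternionAut (.xa 0) = .a 1 * .xa 0 := by decide
    apply quaternionGroup_two_hom_ext
    · simp [ha, quaternionLift_a_one, quaternionLift_xa_zero, hhx]
    · simp only [MonoidHom.comp_apply, MulEquiv.coe_toMonoidHom, hb, map_mul, quaternionLift_a_one,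
        quaternionLift_xa_zero, MulAut.conj_apply, hhy]
  exact DFunLike.congr_fun key q

theorem dvd_card_of_mem {G : Type*} [Group G] {H : Subgroup G} {x : G} {n : ℕ} (hx : x ∈ H)
    (hn : orderOf x = n) : n ∣ Nat.card H := by
  rw [← hn, ← Subgroup.orderOf_mk x hx]
  exact orderOf_dvd_natCard _

/-- A characterization of `Q₈ ⋊ C₃`. -/
theorem nonempty_mulEquiv_Q8sdC3 {G : Type*} [Group G] [Finite G] (hG : Nat.card G = 24)
    {x y h : G} (hx : orderOf x = 4) (hyx : y ^ 2 = x ^ 2) (hxy : y * x * y⁻¹ = x⁻¹)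
    (hh : orderOf h = 3) (hhx : h * x * h⁻¹ = y) (hhy : h * y * h⁻¹ = x * y) :
    Nonempty (G ≃* Q8sdC3) := by
  have hy : y ∉ Subgroup.zpowers x := by
    rintro ⟨k, rfl⟩
    have h1 : x = x⁻¹ := by
      rw [← hxy]
      group
    have h2 : x ^ 2 = 1 := by rw [pow_two, ← eq_inv_iff_mul_eq_one, ← h1]
    have h3 := orderOf_le_of_pow_eq_one (by norm_num) h2
    omega
  have hx4 : x ^ (2 * 2) = 1 := by rw [← orderOf_dvd_iff_pow_eq_one, hx]
  have hh3 : h ^ 3 = 1 := by rw [← orderOf_dvd_iff_pow_eq_one, hh]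
  set q := quaternionLift 2 x y hx4 hyx hxy with hq
  obtain ⟨hr1, hr2⟩ := mem_range_cyclicLift (hf := quaternionAut_pow_three) q h hh3
    (quaternionLift_quaternionAut hx4 hyx hxy hhx hhy)
  set f := cyclicLift (hf := quaternionAut_pow_three) q h hh3
    (quaternionLift_quaternionAut hx4 hyx hxy hhx hhy) with hf
  refine nonempty_mulEquiv_of_range_eq_top f ?_ ?_
  · obtain ⟨hqx, hqy⟩ := mem_range_quaternionLift 2 x y hx4 hyx hxy
    have h4 : 4 ∣ Nat.card q.range := dvd_card_of_mem hqx hx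
    -- The image of Q₈ properly contains ⟨x⟩ of order 4 and has order dividing 8, so it has order 8.
    -- Together with `h` of order 3 this gives all 24 elements.
    have h8 : 4 < Nat.card q.range := by
      have hle : Subgroup.zpowers x ≤ q.range := by simpa using hqx
      have hlt : Subgroup.zpowers x < q.range := lt_of_le_of_ne hle (fun he => hy (he ▸ hqy))
      have hc : Nat.card (Subgroup.zpowers x) = 4 := by rw [Nat.card_zpowers, hx]
      by_contra! hcon
      exact hlt.ne (Subgroup.eq_of_le_of_card_ge hle (by omega))
    have hqf : q.range ≤ f.range := by
      rintro _ ⟨w, rfl⟩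
      exact hr1 w
    have hd := Subgroup.card_dvd_of_le hqf
    have h3 : 3 ∣ Nat.card f.range := dvd_card_of_mem hr2 hh
    have hdG := Subgroup.card_subgroup_dvd_card f.range
    rw [hG] at hdG
    apply Subgroup.eq_top_of_card_eq
    rw [hG]
    have hle := Nat.le_of_dvd (by norm_num) hdG
    have hle' := Nat.le_of_dvd Nat.card_pos hd
    have hd8 : Nat.card q.range ∣ 8 := by
      have := Subgroup.card_range_dvd q
      rwa [Nat.card_eq_fintype_card (α := QuaternionGroup 2), QuaternionGroup.card] at this
    have hle8 := Nat.le_of_dvd (by norm_num) hd8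
    have h8' : Nat.card q.range = 8 := by omega
    rw [h8'] at hd
    omega
  · rw [SemidirectProduct.card, hG]
    simp [Nat.card_eq_fintype_card, QuaternionGroup.card]

theorem nonempty_specialLinearGroup_mulEquiv_Q8sdC3 :
    Nonempty (Matrix.SpecialLinearGroup (Fin 2) (ZMod 3) ≃* Q8sdC3) := by
  -- The matrices `x` and `y` generate a copy of Q₈, and `h` has order three and conjugates `x` to
  -- `y` and `y` to `x * y`.
  refine nonempty_mulEquiv_Q8sdC3 card_specialLinearGroup_two_three
    (x := ⟨!![0, 1; 2, 0], by decide⟩) (y := ⟨!![1, 1; 1, 2], by decide⟩)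
    (h := ⟨!![0, 1; 2, 2], by decide⟩) ?_ (by decide) (by decide) ?_ ?_ ?_
  · exact orderOf_eq_prime_pow (p := 2) (n := 1) (by decide) (by decide)
  · exact orderOf_eq_prime (by decide) fun h => absurd (congrArg Subtype.val h) (by decide)
  · exact Subtype.ext (by decide)
  · exact Subtype.ext (by decide)

/-- The action of `C₅ ⋊ C₄` on the line over the field with five elements. -/
def C5sdC4.toGA15 : C5sdC4 →* GA15 :=
  cyclicLift ((AffineEquiv.constVAddHom (ZMod 5) (ZMod 5)))
    (LinearEquiv.smulOfUnit (⟨2, 3, by decide, by decide⟩ : (ZMod 5)ˣ)).toAffineEquiv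
    (by ext x; revert x; decide) (by decide +kernel)

theorem C5sdC4.toGA15_apply (g : C5sdC4) (x : ZMod 5) : C5sdC4.toGA15 g x =
    Multiplicative.toAdd g.left + 2 ^ (Multiplicative.toAdd g.right).val * x := by
  have key : ∀ k : ℕ, ((LinearEquiv.smulOfUnit (⟨2, 3, by decide, by decide⟩ :
      (ZMod 5)ˣ)).toAffineEquiv ^ k : GA15) x = 2 ^ k * x := by
    intro k
    induction k with
    | zero => simp
    | succ k ih =>
      rw [pow_succ', AffineEquiv.mul_def, AffineEquiv.trans_apply, ih, pow_succ', mul_assoc]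
      rfl
  rw [← key]
  rfl

/-- An affine map of the line is determined by its values at 0 and 1: the translation part is `e 0`,
and the slope `e 1 - e 0` is a power of 2 because 2 generates the units modulo 5. -/
theorem nonempty_GA15_mulEquiv : Nonempty (GA15 ≃* C5sdC4) := by
  refine ⟨(MulEquiv.ofBijective C5sdC4.toGA15 ⟨?_, ?_⟩).symm⟩
  · rw [injective_iff_map_eq_one]
    intro g hg
    have h0 := C5sdC4.toGA15_apply g 0
    have h1 := C5sdC4.toGA15_apply g 1
    rw [hg] at h0 h1
    have : ∀ g : C5sdC4, (0 : ZMod 5) = Multiplicative.toAdd g.left +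
        2 ^ (Multiplicative.toAdd g.right).val * 0 → (1 : ZMod 5) = Multiplicative.toAdd g.left +
        2 ^ (Multiplicative.toAdd g.right).val * 1 → g = 1 := by decide
    exact this g h0 h1
  · intro e
    have h1 : ∀ x, e x = e 0 + x * (e 1 - e 0) := by
      intro x
      have h2 := e.map_vadd 0 x
      have h3 := e.map_vadd 0 1
      simp only [vadd_eq_add, add_zero] at h2 h3
      rw [h2, h3, add_sub_cancel_right, add_comm (e 0), ← smul_eq_mul x, ← map_smul, smul_eq_mul,
        mul_one]
    have h2 : ∀ u : ZMod 5, u ≠ 0 → ∃ k : ZMod 4, u = 2 ^ k.val := by decide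
    obtain ⟨k, hk⟩ := h2 (e 1 - e 0) (sub_ne_zero.mpr (e.injective.ne (by decide)))
    refine ⟨⟨.ofAdd (e 0), .ofAdd k⟩, ?_⟩
    ext x
    rw [C5sdC4.toGA15_apply, h1 x, hk, mul_comm x]
    rfl

/-! ### The sixteen groups are strong 4-star free -/

/-- The finite non-abelian strong `4`-star free groups. -/
def IsFiniteNonabelianStarFree (G : Type*) [Group G] : Prop :=
  Finite G ∧ (∃ a b : G, a * b ≠ b * a) ∧ StrongStarFree 4 G

theorem IsFiniteNonabelianStarFree.congr {G H : Type*} [Group G] [Group H]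
    (h : IsFiniteNonabelianStarFree H) (e : Nonempty (G ≃* H)) : IsFiniteNonabelianStarFree G := by
  obtain ⟨e⟩ := e
  obtain ⟨h1, ⟨a, b, hab⟩, h3⟩ := h
  refine ⟨Finite.of_equiv H e.symm.toEquiv, ⟨e.symm a, e.symm b, fun he => hab ?_⟩, h3.congr e⟩
  rw [← map_mul, ← map_mul] at he
  exact e.symm.injective he

theorem SmallCentralizers.isFiniteNonabelianStarFree {G : Type*} [Group G] [Finite G]
    (h : SmallCentralizers G) (hn : ∃ a b : G, a * b ≠ b * a) : IsFiniteNonabelianStarFree G :=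
  ⟨inferInstance, hn, strongStarFree_four_iff.mpr h⟩

/-- Only enough central elements need be exhibited: one for orders up to 11, two for order 12, four
for order 16. -/
theorem isFiniteNonabelianStarFree_of_card_le {G : Type*} [Group G] [Fintype G] (S : Finset G)
    (hS : ∀ z ∈ S, ∀ g : G, g * z = z * g) (hG : Fintype.card G ≤ 2 * S.card + 9)
    (hn : ∃ a b : G, a * b ≠ b * a) : IsFiniteNonabelianStarFree G := by
  refine (smallCentralizers_of_card_le ?_).isFiniteNonabelianStarFree hn
  have := card_le_card_center S hS
  rw [Nat.card_eq_fintype_card]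
  omega

theorem isFiniteNonabelianStarFree_perm_three : IsFiniteNonabelianStarFree (Equiv.Perm (Fin 3)) :=
  isFiniteNonabelianStarFree_of_card_le {1} (by decide) (by decide) (by decide)

theorem isFiniteNonabelianStarFree_alternatingGroup_four :
    IsFiniteNonabelianStarFree (alternatingGroup (Fin 4)) :=
  smallCentralizers_alternatingGroup_four.isFiniteNonabelianStarFree
    ⟨⟨Equiv.swap 0 1 * Equiv.swap 1 2, Equiv.Perm.mem_alternatingGroup.mpr (by decide)⟩,
      ⟨Equiv.swap 0 1 * Equiv.swap 1 3, Equiv.Perm.mem_alternatingGroup.mpr (by decide)⟩, by decide⟩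

theorem isFiniteNonabelianStarFree_alternatingGroup_five :
    IsFiniteNonabelianStarFree (alternatingGroup (Fin 5)) :=
  smallCentralizers_alternatingGroup_five.isFiniteNonabelianStarFree
    ⟨⟨Equiv.swap 0 1 * Equiv.swap 1 2, Equiv.Perm.mem_alternatingGroup.mpr (by decide)⟩,
      ⟨Equiv.swap 0 1 * Equiv.swap 1 3, Equiv.Perm.mem_alternatingGroup.mpr (by decide)⟩, by decide⟩

theorem isFiniteNonabelianStarFree_dihedral_four : IsFiniteNonabelianStarFree (DihedralGroup 4) :=
  isFiniteNonabelianStarFree_of_card_le {1} (by simp) (by decide) ⟨.r 1, .sr 0, by decide⟩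

theorem isFiniteNonabelianStarFree_dihedral_five : IsFiniteNonabelianStarFree (DihedralGroup 5) :=
  isFiniteNonabelianStarFree_of_card_le {1} (by simp) (by decide) ⟨.r 1, .sr 0, by decide⟩

theorem isFiniteNonabelianStarFree_GA15 : IsFiniteNonabelianStarFree GA15 :=
  (smallCentralizers_C5sdC4.isFiniteNonabelianStarFree
    ⟨.inl (.ofAdd 1), .inr (.ofAdd 1), by decide⟩).congr nonempty_GA15_mulEquiv

theorem isFiniteNonabelianStarFree_quaternion : IsFiniteNonabelianStarFree (QuaternionGroup 2) :=
  isFiniteNonabelianStarFree_of_card_le {1} (by simp) (by decide) ⟨.a 1, .xa 0, by decide⟩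

theorem isFiniteNonabelianStarFree_dihedral_six : IsFiniteNonabelianStarFree (DihedralGroup 6) :=
  isFiniteNonabelianStarFree_of_card_le {1, .r 3} (by decide) (by decide) ⟨.r 1, .sr 0, by decide⟩

theorem isFiniteNonabelianStarFree_C3sdC4 : IsFiniteNonabelianStarFree C3sdC4 :=
  isFiniteNonabelianStarFree_of_card_le {1, .inr (.ofAdd 2)} (by decide) (by decide)
    ⟨.inl (.ofAdd 1), .inr (.ofAdd 1), by decide⟩

theorem isFiniteNonabelianStarFree_specialLinearGroup :
    IsFiniteNonabelianStarFree (Matrix.SpecialLinearGroup (Fin 2) (ZMod 3)) :=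
  (smallCentralizers_Q8sdC3.isFiniteNonabelianStarFree
    ⟨.inl (.a 1), .inr (.ofAdd 1), by decide⟩).congr nonempty_specialLinearGroup_mulEquiv_Q8sdC3

theorem isFiniteNonabelianStarFree_shear : IsFiniteNonabelianStarFree C4C2sdC2shear :=
  isFiniteNonabelianStarFree_of_card_le
    {1, .inl (.ofAdd 2, 1), .inl (1, .ofAdd 1), .inl (.ofAdd 2, .ofAdd 1)} (by decide +kernel)
    (by decide) ⟨.inl (.ofAdd 1, 1), .inr (.ofAdd 1), by decide⟩

theorem isFiniteNonabelianStarFree_C4sdC4 : IsFiniteNonabelianStarFree C4sdC4 :=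
  isFiniteNonabelianStarFree_of_card_le
    {1, .inl (.ofAdd 2), .inr (.ofAdd 2), .inl (.ofAdd 2) * .inr (.ofAdd 2)} (by decide +kernel)
    (by decide) ⟨.inl (.ofAdd 1), .inr (.ofAdd 1), by decide⟩

theorem isFiniteNonabelianStarFree_C8sdC2 : IsFiniteNonabelianStarFree C8sdC2 :=
  isFiniteNonabelianStarFree_of_card_le
    {1, .inl (.ofAdd 2), .inl (.ofAdd 4), .inl (.ofAdd 6)} (by decide +kernel)
    (by decide) ⟨.inl (.ofAdd 1), .inr (.ofAdd 1), by decide⟩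

theorem isFiniteNonabelianStarFree_dihedral_four_prod :
    IsFiniteNonabelianStarFree (DihedralGroup 4 × Cyc 2) :=
  isFiniteNonabelianStarFree_of_card_le
    {1, (.r 2, 1), (1, .ofAdd 1), (.r 2, .ofAdd 1)} (by decide +kernel)
    (by decide) ⟨(.r 1, 1), (.sr 0, 1), by decide⟩

theorem isFiniteNonabelianStarFree_quaternion_prod :
    IsFiniteNonabelianStarFree (QuaternionGroup 2 × Cyc 2) :=
  isFiniteNonabelianStarFree_of_card_le
    {1, (.a 2, 1), (1, .ofAdd 1), (.a 2, .ofAdd 1)} (by decide +kernel)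
    (by decide) ⟨(.a 1, 1), (.xa 0, 1), by decide⟩

theorem isFiniteNonabelianStarFree_twist : IsFiniteNonabelianStarFree C4C2sdC2twist :=
  isFiniteNonabelianStarFree_of_card_le
    {1, .inl (.ofAdd 1, 1), .inl (.ofAdd 2, 1), .inl (.ofAdd 3, 1)} (by decide +kernel)
    (by decide) ⟨.inl (1, .ofAdd 1), .inr (.ofAdd 1), by decide⟩

/-! ### Possible orders of centre, centralizers and group -/

theorem card_center_dvd_card_centralizer {G : Type*} [Group G] [Finite G] (x : G) :
    Nat.card (Subgroup.center G) ∣ Nat.card (Subgroup.centralizer {x}) :=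
  Subgroup.card_dvd_of_le (Subgroup.center_le_centralizer _)

theorem card_center_lt_card_centralizer {G : Type*} [Group G] [Finite G] {x : G}
    (hx : x ∉ Subgroup.center G) :
    Nat.card (Subgroup.center G) < Nat.card (Subgroup.centralizer {x}) := by
  by_contra! h
  have := Subgroup.eq_of_le_of_card_ge (Subgroup.center_le_centralizer {x}) h
  exact hx (this ▸ mem_centralizer_singleton.mpr rfl)

theorem exists_notMem_center {G : Type*} [Group G] (hn : ∃ a b : G, a * b ≠ b * a) :
    ∃ x : G, x ∉ Subgroup.center G := by
  obtain ⟨a, b, hab⟩ := hn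
  exact ⟨b, fun h => hab (Subgroup.mem_center_iff.mp h a)⟩

/-- The possible orders of a proper centralizer. -/
theorem SmallCentralizers.card_cases {G : Type*} [Group G] [Finite G] (h : SmallCentralizers G)
    {x : G} (hx : x ∉ Subgroup.center G) :
    (Nat.card (Subgroup.center G) = 1 ∧
      Nat.card (Subgroup.centralizer {x}) ∈ ({2, 3, 4, 5} : Finset ℕ)) ∨
    (Nat.card (Subgroup.center G) = 2 ∧
      Nat.card (Subgroup.centralizer {x}) ∈ ({4, 6} : Finset ℕ)) ∨
    (Nat.card (Subgroup.center G) = 3 ∧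
      Nat.card (Subgroup.centralizer {x}) ∈ ({6} : Finset ℕ)) ∨
    (Nat.card (Subgroup.center G) = 4 ∧
      Nat.card (Subgroup.centralizer {x}) ∈ ({8} : Finset ℕ)) := by
  have h1 := h x hx
  have h2 := card_center_lt_card_centralizer hx
  obtain ⟨k, hk⟩ := card_center_dvd_card_centralizer x
  have h3 : 0 < Nat.card (Subgroup.center G) := Nat.card_pos
  set z := Nat.card (Subgroup.center G)
  set c := Nat.card (Subgroup.centralizer {x})
  -- `c` is a proper multiple of `z`, so 2z ≤ c ≤ z + 4.
  have hz : z ≤ 4 := by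
    rcases k with - | - | k
    · omega
    · omega
    · nlinarith
  simp only [Finset.mem_insert, Finset.mem_singleton]
  interval_cases z <;> omega

theorem exists_centralizerCount_mul_eq (G : Type*) [Group G] [Finite G] (k : ℕ) :
    ∃ m, centralizerCount G k * k = Nat.card G * m :=
  card_dvd_centralizerCount_mul G k

theorem card_centralizer_ne_card {G : Type*} [Group G] [Finite G] {x : G}
    (hx : x ∉ Subgroup.center G) : Nat.card (Subgroup.centralizer {x}) ≠ Nat.card G :=
  fun h => hx (mem_center_iff_card_centralizer.mpr h)

theorem not_isPGroup_of_card_center_eq_one {G : Type*} [Group G] [Finite G] [Nontrivial G]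
    (hz : Nat.card (Subgroup.center G) = 1) (p n : ℕ) [Fact p.Prime] : Nat.card G ≠ p ^ n := by
  intro h
  have := (IsPGroup.of_card h).center_nontrivial
  have := Finite.one_lt_card (α := Subgroup.center G)
  omega

theorem card_cases_of_card_center_eq_one {G : Type*} [Group G] [Finite G] [Nontrivial G]
    (h : ∀ x : G, x ≠ 1 → Nat.card (Subgroup.centralizer {x}) ∈ ({2, 3, 4, 5} : Finset ℕ))
    (hz : Nat.card (Subgroup.center G) = 1) :
    Nat.card G = 6 ∨ Nat.card G = 10 ∨ Nat.card G = 12 ∨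
      (Nat.card G = 15 ∧ centralizerCount G 3 = 5) ∨
      (Nat.card G = 20 ∧ centralizerCount G 5 = 4) ∨
      (Nat.card G = 60 ∧ centralizerCount G 4 = 15) := by
  have h2 := not_isPGroup_of_card_center_eq_one hz 2 1
  have h4 := not_isPGroup_of_card_center_eq_one hz 2 2
  have h3 := not_isPGroup_of_card_center_eq_one hz 3 1
  have := Fact.mk Nat.prime_five
  have h5 := not_isPGroup_of_card_center_eq_one hz 5 1
  have h1 : 1 < Nat.card G := Finite.one_lt_card
  have hsum := card_eq_center_add_sum G {2, 3, 4, 5}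
    (fun x hx => h x fun h1 => hx (h1 ▸ Subgroup.one_mem _))
    (by simp only [Finset.mem_insert, Finset.mem_singleton]; omega)
  obtain ⟨a, ha⟩ := exists_centralizerCount_mul_eq G 2
  obtain ⟨b, hb⟩ := exists_centralizerCount_mul_eq G 3
  obtain ⟨c, hc⟩ := exists_centralizerCount_mul_eq G 4
  obtain ⟨d, hd⟩ := exists_centralizerCount_mul_eq G 5
  simp [hz] at hsum
  set g := Nat.card G
  set n2 := centralizerCount G 2
  set n3 := centralizerCount G 3
  set n4 := centralizerCount G 4
  set n5 := centralizerCount G 5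
  -- The class equation times 60 = lcm(2, 3, 4, 5), with each k·n_k replaced by a multiple of g.
  have key : g * 60 = 60 + g * (30 * a + 20 * b + 15 * c + 12 * d) := by linarith
  have hg : g ∣ 60 := by
    rw [← Nat.dvd_add_left (dvd_mul_right g (30 * a + 20 * b + 15 * c + 12 * d)), ← key]
    exact dvd_mul_right _ _
  have hmem : g ∈ Nat.divisors 60 := by simp [hg]
  have hdiv : Nat.divisors 60 = {1, 2, 3, 4, 5, 6, 10, 12, 15, 20, 30, 60} := by decide
  rw [hdiv] at hmem
  clear_value g n2 n3 n4 n5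
  simp only [Finset.mem_insert, Finset.mem_singleton] at hmem
  rcases hmem with rfl | rfl | rfl | rfl | rfl | rfl | rfl | rfl | rfl | rfl | rfl | rfl <;> omega

/-- In order 24 the class equation leaves the counts (6, 16) or (18, 4) for centralizer orders 4 and
6. The implication records that more than four elements of the second kind select the first pair. -/
theorem card_cases_of_card_center_eq_two {G : Type*} [Group G] [Finite G]
    (hn : ∃ a b : G, a * b ≠ b * a)
    (h : ∀ x : G, x ∉ Subgroup.center G →
      Nat.card (Subgroup.centralizer {x}) ∈ ({4, 6} : Finset ℕ))
    (hz : Nat.card (Subgroup.center G) = 2) :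
    Nat.card G = 8 ∨ Nat.card G = 12 ∨
      (Nat.card G = 24 ∧ (4 < centralizerCount G 6 → centralizerCount G 4 = 6)) := by
  obtain ⟨x, hx⟩ := exists_notMem_center hn
  have h1 := card_centralizer_ne_card hx
  have h2 := h x hx
  have h3 := Subgroup.card_subgroup_dvd_card (Subgroup.centralizer {x})
  have hpos : 0 < Nat.card G := Nat.card_pos
  have h4 := Nat.le_of_dvd hpos h3
  have hK : Nat.card G ∉ ({4, 6} : Finset ℕ) := by
    simp only [Finset.mem_insert, Finset.mem_singleton] at h2 ⊢
    rcases h2 with h2 | h2 <;> rw [h2] at h1 h3 h4 <;> omega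
  have hsum := card_eq_center_add_sum G {4, 6} h hK
  obtain ⟨a, ha⟩ := exists_centralizerCount_mul_eq G 4
  obtain ⟨b, hb⟩ := exists_centralizerCount_mul_eq G 6
  simp [hz] at hsum
  have hK' : Nat.card G ≠ 4 ∧ Nat.card G ≠ 6 := by simpa using hK
  have h42 : 4 ≤ Nat.card G := by
    simp only [Finset.mem_insert, Finset.mem_singleton] at h2
    omega
  set g := Nat.card G
  set n4 := centralizerCount G 4
  set n6 := centralizerCount G 6
  have key : g * 12 = 24 + g * (3 * a + 2 * b) := by linarith
  have hg : g ∣ 24 := by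
    rw [← Nat.dvd_add_left (dvd_mul_right g (3 * a + 2 * b)), ← key]
    exact dvd_mul_right _ _
  have hmem : g ∈ Nat.divisors 24 := by simp [hg]
  have hdiv : Nat.divisors 24 = {1, 2, 3, 4, 6, 8, 12, 24} := by decide
  rw [hdiv] at hmem
  clear_value g n4 n6
  simp only [Finset.mem_insert, Finset.mem_singleton] at hmem
  rcases hmem with rfl | rfl | rfl | rfl | rfl | rfl | rfl | rfl <;> omega

theorem card_cases_of_card_centralizer_eq {G : Type*} [Group G] [Finite G]
    (hn : ∃ a b : G, a * b ≠ b * a) {z : ℕ}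
    (h : ∀ x : G, x ∉ Subgroup.center G → Nat.card (Subgroup.centralizer {x}) ∈ ({2 * z} : Finset ℕ))
    (hz : Nat.card (Subgroup.center G) = z) :
    ∃ m, Nat.card G * (2 * z) = 2 * z * z + Nat.card G * m ∧ 2 * z ∣ Nat.card G ∧
      Nat.card G ≠ 2 * z := by
  obtain ⟨x, hx⟩ := exists_notMem_center hn
  have h1 := card_centralizer_ne_card hx
  have h2 := Finset.mem_singleton.mp (h x hx)
  have h3 := Subgroup.card_subgroup_dvd_card (Subgroup.centralizer {x})
  rw [h2] at h1 h3
  have hsum := card_eq_center_add_sum G {2 * z} h (by simpa using h1.symm)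
  obtain ⟨m, hm⟩ := exists_centralizerCount_mul_eq G (2 * z)
  refine ⟨m, ?_, h3, h1.symm⟩
  simp [hz] at hsum
  rw [← hm]
  conv_lhs => rw [hsum]
  ring

theorem card_eq_of_card_center_eq_four {G : Type*} [Group G] [Finite G]
    (hn : ∃ a b : G, a * b ≠ b * a)
    (h : ∀ x : G, x ∉ Subgroup.center G →
      Nat.card (Subgroup.centralizer {x}) ∈ ({8} : Finset ℕ))
    (hz : Nat.card (Subgroup.center G) = 4) : Nat.card G = 16 ∨ Nat.card G = 32 := by
  obtain ⟨m, h1, ⟨k, hk⟩, h3⟩ := card_cases_of_card_centralizer_eq hn h hz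
  rw [hk] at h1 h3 ⊢
  -- With |G| = 8k the class equation reads 8k = 4 + km. The subtraction is honest, as m ≥ 8
  -- contradicts the equation.
  have hk4 : k * (8 - m) = 4 := by
    rcases le_total m 8 with h | h
    · obtain ⟨j, hj⟩ := Nat.exists_eq_add_of_le h
      have h5 : 2 * 4 * k * (m + j) = 2 * 4 * k * m + 8 * (k * j) := by ring
      rw [hj, Nat.add_sub_cancel_left]
      rw [← hj] at h5
      omega
    · nlinarith
  have hkd : k ∣ 4 := ⟨_, hk4.symm⟩
  have := Nat.le_of_dvd (by norm_num) hkd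
  interval_cases k <;> omega

theorem card_eq_of_card_center_eq_three {G : Type*} [Group G] [Finite G]
    (hn : ∃ a b : G, a * b ≠ b * a)
    (h : ∀ x : G, x ∉ Subgroup.center G →
      Nat.card (Subgroup.centralizer {x}) ∈ ({6} : Finset ℕ))
    (hz : Nat.card (Subgroup.center G) = 3) : Nat.card G = 18 := by
  obtain ⟨m, h1, ⟨k, hk⟩, h3⟩ := card_cases_of_card_centralizer_eq hn h hz
  rw [hk] at h1 h3 ⊢
  have hkd : k ∣ 3 := by
    have : k * 6 = 3 + k * m := by nlinarith
    rw [← Nat.dvd_add_left (dvd_mul_right k m), ← this]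
    exact dvd_mul_right _ _
  have := Nat.le_of_dvd (by norm_num) hkd
  interval_cases k <;> omega

/-- In a group of order 18, a subgroup of order 9 is abelian and too large to be central, so it lies
in the centralizer of one of its noncentral elements; but 9 does not divide 6. -/
theorem card_center_ne_three {G : Type*} [Group G] [Finite G] (hn : ∃ a b : G, a * b ≠ b * a)
    (h : ∀ x : G, x ∉ Subgroup.center G →
      Nat.card (Subgroup.centralizer {x}) ∈ ({6} : Finset ℕ)) :
    Nat.card (Subgroup.center G) ≠ 3 := by
  intro hz
  have hG := card_eq_of_card_center_eq_three hn h hz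
  have := Fact.mk Nat.prime_three
  obtain ⟨P, hP⟩ := Sylow.exists_subgroup_card_pow_prime 3 (n := 2) (G := G) (by rw [hG]; norm_num)
  have hcomm := IsPGroup.isMulCommutative_of_card_eq_prime_sq hP
  have : ∃ x ∈ P, x ∉ Subgroup.center G := by
    by_contra! hle
    have := Nat.le_of_dvd (by omega) (Subgroup.card_dvd_of_le (show P ≤ Subgroup.center G from hle))
    omega
  obtain ⟨x, hxP, hx⟩ := this
  have hle : P ≤ Subgroup.centralizer {x} := by
    intro y hy
    rw [mem_centralizer_singleton]
    exact congrArg Subtype.val (hcomm.is_comm.comm (⟨y, hy⟩ : P) ⟨x, hxP⟩)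
  have h1 := Subgroup.card_dvd_of_le hle
  rw [hP, Finset.mem_singleton.mp (h x hx)] at h1
  norm_num at h1

/-! ### Trivial centre -/

/-- The kernel of the action on the cosets of `H` is the normal core. -/
theorem exists_injective_toPerm {G : Type*} [Group G] [Finite G] (H : Subgroup G)
    (hH : H.normalCore = ⊥) {n : ℕ} (hn : Nat.card H * n = Nat.card G) :
    ∃ f : G →* Equiv.Perm (Fin n), Function.Injective f := by
  have hidx : Nat.card (G ⧸ H) = n := by
    have h1 := H.card_mul_index
    rw [← hn] at h1
    exact Nat.eq_of_mul_eq_mul_left Nat.card_pos h1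
  let e : (G ⧸ H) ≃ Fin n := Finite.equivFinOfCardEq hidx
  refine ⟨(e.permCongrHom.toMonoidHom).comp (MulAction.toPermHom G (G ⧸ H)), ?_⟩
  refine e.permCongrHom.injective.comp ?_
  rw [← MonoidHom.ker_eq_bot_iff, ← Subgroup.normalCore_eq_ker, hH]

theorem nonempty_mulEquiv_perm {G : Type*} [Group G] [Finite G] (H : Subgroup G)
    (hH : H.normalCore = ⊥) {n : ℕ} (hn : Nat.card H * n = Nat.card G)
    (hc : Nat.card G = n.factorial) : Nonempty (G ≃* Equiv.Perm (Fin n)) := by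
  obtain ⟨f, hf⟩ := exists_injective_toPerm H hH hn
  refine ⟨MulEquiv.ofBijective f ((Nat.bijective_iff_injective_and_card f).mpr ⟨hf, ?_⟩)⟩
  rw [hc, Nat.card_perm, Nat.card_fin]

/-- The image of the coset action has index two in the symmetric group, and the alternating group is
the only such subgroup. -/
theorem nonempty_mulEquiv_alternatingGroup {G : Type*} [Group G] [Finite G] (H : Subgroup G)
    (hH : H.normalCore = ⊥) {n : ℕ} (hn : Nat.card H * n = Nat.card G)
    (hc : 2 * Nat.card G = n.factorial) : Nonempty (G ≃* alternatingGroup (Fin n)) := by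
  obtain ⟨f, hf⟩ := exists_injective_toPerm H hH hn
  have h1 : Nat.card f.range = Nat.card G :=
    (Nat.card_congr (MonoidHom.ofInjective hf).toEquiv).symm
  have h2 : f.range.index = 2 := by
    have h3 := f.range.card_mul_index
    rw [Nat.card_perm, Nat.card_fin, ← hc, h1, mul_comm] at h3
    exact Nat.eq_of_mul_eq_mul_right Nat.card_pos h3
  exact ⟨(MonoidHom.ofInjective hf).trans
    (MulEquiv.subgroupCongr (Equiv.Perm.eq_alternatingGroup_of_index_eq_two h2))⟩

theorem card_conjClass_lt_of_normal {G : Type*} [Group G] [Finite G] (N : Subgroup G) [N.Normal]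
    {x : G} (hx : x ∈ N) (hx1 : x ≠ 1) : Set.ncard {y : G | IsConj x y} < Nat.card N := by
  change _ < Set.ncard (N : Set G)
  apply Set.ncard_lt_ncard _ (Set.toFinite _)
  refine ⟨fun y hy => ?_, fun h => ?_⟩
  · obtain ⟨g, rfl⟩ := isConj_iff.mp hy
    exact Subgroup.Normal.conj_mem inferInstance x hx g
  · have : IsConj x 1 := h N.one_mem
    exact hx1 (isConj_one_left.mp this)

/-- A nontrivial normal subgroup contains the identity and a class of at least |G|/5 elements, too
many to fit in `H`. -/
theorem normalCore_eq_bot_of_card_lt {G : Type*} [Group G] [Finite G]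
    (h : ∀ x : G, x ≠ 1 → Nat.card (Subgroup.centralizer {x}) ≤ 5) (H : Subgroup G)
    (hH : 5 * Nat.card H < Nat.card G + 5) : H.normalCore = ⊥ := by
  rw [Subgroup.eq_bot_iff_forall]
  intro x hx
  by_contra hx1
  have h1 := card_conjClass_lt_of_normal H.normalCore hx hx1
  have h2 := card_conjClass_mul_card_centralizer x
  have h3 := h x hx1
  have h4 := Nat.le_of_dvd Nat.card_pos (Subgroup.card_dvd_of_le H.normalCore_le)
  nlinarith

theorem zpowers_le_centralizer {G : Type*} [Group G] (a : G) :
    Subgroup.zpowers a ≤ Subgroup.centralizer {a} := by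
  simp [mem_centralizer_singleton]

theorem centralizer_eq_zpowers {G : Type*} [Group G] [Finite G] {a : G}
    (h : Nat.card (Subgroup.centralizer {a}) ≤ orderOf a) :
    Subgroup.centralizer {a} = Subgroup.zpowers a :=
  (Subgroup.eq_of_le_of_card_ge (zpowers_le_centralizer a) (by rwa [Nat.card_zpowers])).symm

theorem nonempty_mulEquiv_dihedralGroup_five {G : Type*} [Group G] [Finite G]
    (hG : Nat.card G = 10)
    (h : ∀ x : G, x ≠ 1 → Nat.card (Subgroup.centralizer {x}) ≤ 5) :
    Nonempty (G ≃* DihedralGroup 5) := by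
  have := Fact.mk Nat.prime_five
  obtain ⟨a, ha⟩ := exists_prime_orderOf_dvd_card' (G := G) 5 (by rw [hG]; norm_num)
  have ha1 : a ≠ 1 := by
    rintro rfl
    simp at ha
  have hC : Subgroup.centralizer {a} = Subgroup.zpowers a :=
    centralizer_eq_zpowers (by rw [ha]; exact h a ha1)
  have hidx : (Subgroup.zpowers a).index = 2 := by
    have := (Subgroup.zpowers a).card_mul_index
    rw [Nat.card_zpowers, ha, hG] at this
    omega
  -- Otherwise `g ^ 2` generates ⟨a⟩, so `g` commutes with `a` and lies in its centralizer ⟨a⟩.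
  -- Applied to `b` and `b * a`, this gives the dihedral relations.
  have hsq : ∀ g, g ∉ Subgroup.zpowers a → g ^ 2 = 1 := by
    intro g hg
    by_contra hg1
    have hm : g ^ 2 ∈ Subgroup.zpowers a := Subgroup.sq_mem_of_index_two hidx g
    have he : Subgroup.zpowers (g ^ 2) = Subgroup.zpowers a := by
      apply Subgroup.eq_of_le_of_card_ge (by simpa using hm)
      have := Subgroup.card_dvd_of_le (show Subgroup.zpowers (g ^ 2) ≤ Subgroup.zpowers a by
        simpa using hm)
      rw [Nat.card_zpowers, Nat.card_zpowers, ha, Nat.dvd_prime Nat.prime_five] at this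
      rw [Nat.card_zpowers, Nat.card_zpowers, ha]
      rcases this with h | h
      · exact absurd (orderOf_eq_one_iff.mp h) hg1
      · exact h.ge
    have ham : a ∈ Subgroup.zpowers (g ^ 2) := he ▸ Subgroup.mem_zpowers a
    apply hg
    rw [← hC, mem_centralizer_singleton]
    obtain ⟨k, rfl⟩ := ham
    exact ((Commute.refl g).pow_right 2).zpow_right k
  obtain ⟨b, hb⟩ : ∃ b, b ∉ Subgroup.zpowers a := by
    by_contra! hall
    rw [(Subgroup.eq_top_iff' _).mpr hall] at hidx
    simp at hidx
  have hb2 := hsq b hb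
  have hba := hsq (b * a) (by
    rwa [Subgroup.mul_mem_cancel_right _ (Subgroup.mem_zpowers a)])
  have hconj : b * a * b⁻¹ = a⁻¹ := by
    have hb' : b⁻¹ = b := by rw [inv_eq_iff_mul_eq_one, ← pow_two, hb2]
    rw [hb', eq_inv_iff_mul_eq_one, mul_assoc, ← pow_two, hba]
  have ha5 : a ^ 5 = 1 := by rw [← orderOf_dvd_iff_pow_eq_one, ha]
  obtain ⟨h1, h2⟩ := mem_range_dihedralLift 5 a b ha5 hb2 hconj
  refine nonempty_mulEquiv_of_range_eq_top (dihedralLift 5 a b ha5 hb2 hconj) ?_ ?_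
  · have h5 := dvd_card_of_mem h1 ha
    have hb1 : orderOf b = 2 := orderOf_eq_prime hb2 fun h => hb (h ▸ Subgroup.one_mem _)
    have h2 := dvd_card_of_mem h2 hb1
    apply Subgroup.eq_top_of_card_eq
    have h3 := Subgroup.card_subgroup_dvd_card (dihedralLift 5 a b ha5 hb2 hconj).range
    rw [hG] at h3 ⊢
    have := Nat.le_of_dvd (by norm_num) h3
    have := Nat.pos_of_dvd_of_pos h3 (by norm_num)
    omega
  · rw [hG, DihedralGroup.nat_card]

/-- The elements with centralizer of order `k` form one conjugacy class if there are at most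
`|G| / k` of them. -/
theorem conjClass_eq {G : Type*} [Group G] [Finite G] {x : G} {k : ℕ}
    (hx : Nat.card (Subgroup.centralizer {x}) = k) (hk : centralizerCount G k * k ≤ Nat.card G) :
    {y : G | IsConj x y} = {y : G | Nat.card (Subgroup.centralizer {y}) = k} := by
  have h1 := card_conjClass_mul_card_centralizer x
  rw [hx] at h1
  refine Set.eq_of_subset_of_ncard_le ?_ ?_ (Set.toFinite _)
  · intro y hy
    exact (card_centralizer_of_isConj hy).symm.trans hx
  · change centralizerCount G k ≤ _
    rw [← h1] at hk
    exact Nat.le_of_mul_le_mul_right hk (hx ▸ Nat.card_pos)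

/-- The count makes the elements with centralizer of order three a single class, so some `g`
conjugates `y` to `y⁻¹`. Then `g ^ 2` commutes with `y`, and so does `g`, a power of `g ^ 2` since
|G| is odd. -/
theorem not_card_eq_fifteen {G : Type*} [Group G] [Finite G] (hG : Nat.card G = 15)
    (h : ∀ x : G, x ≠ 1 → Nat.card (Subgroup.centralizer {x}) ≤ 5)
    (hcount : centralizerCount G 3 = 5) : False := by
  obtain ⟨y, hy⟩ := exists_prime_orderOf_dvd_card' (G := G) 3 (by rw [hG]; norm_num)
  have hyi : orderOf y⁻¹ = 3 := by rw [orderOf_inv, hy]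
  have hC : ∀ x : G, orderOf x = 3 → Nat.card (Subgroup.centralizer {x}) = 3 := by
    intro x hx
    have h1 : x ≠ 1 := by
      rintro rfl
      simp at hx
    have h2 := h x h1
    have h3 := dvd_card_of_mem (mem_centralizer_singleton.mpr (rfl : x * x = x * x)) hx
    have h4 : 0 < Nat.card (Subgroup.centralizer {x}) := Nat.card_pos
    omega
  have hclass := conjClass_eq (hC y hy) (by omega)
  have hconj : IsConj y y⁻¹ := by
    have : y⁻¹ ∈ {x : G | Nat.card (Subgroup.centralizer {x}) = 3} := hC _ hyi
    rwa [← hclass] at this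
  obtain ⟨g, hg⟩ := isConj_iff.mp hconj
  have hg2 : Commute (g ^ 2) y := by
    have h1 : g ^ 2 * y * (g ^ 2)⁻¹ = g * (g * y * g⁻¹) * g⁻¹ := by
      rw [pow_two]
      group
    rw [hg, ← conj_inv, hg, inv_inv] at h1
    exact mul_inv_eq_iff_eq_mul.mp h1
  have hgy : Commute g y := by
    have h1 : g ^ 15 = 1 := by rw [← hG, pow_card_eq_one']
    have h2 : (g ^ 2) ^ 8 = g := by
      rw [← pow_mul, show 2 * 8 = 15 + 1 by norm_num, pow_succ, h1, one_mul]
    rw [← h2]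
    exact hg2.pow_left 8
  have h1 : y = y⁻¹ := by
    rw [← hg, hgy.eq, mul_inv_cancel_right]
  have h2 : y ^ 2 = 1 := by rw [pow_two, ← eq_inv_iff_mul_eq_one, ← h1]
  have h3 := orderOf_le_of_pow_eq_one (by norm_num) h2
  omega

theorem nonempty_mulEquiv_C5sdC4 {G : Type*} [Group G] [Finite G] (hG : Nat.card G = 20)
    (h : ∀ x : G, x ≠ 1 → Nat.card (Subgroup.centralizer {x}) ≤ 5)
    (hcount : centralizerCount G 5 = 4) : Nonempty (G ≃* C5sdC4) := by
  have := Fact.mk Nat.prime_five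
  obtain ⟨a, ha⟩ := exists_prime_orderOf_dvd_card' (G := G) 5 (by rw [hG]; norm_num)
  have ha5 : a ^ 5 = 1 := by rw [← orderOf_dvd_iff_pow_eq_one, ha]
  have hne : ∀ k, 0 < k → k < 5 → a ^ k ≠ 1 := fun k hk hk5 he => by
    have := orderOf_le_of_pow_eq_one hk he
    omega
  have ha1 : a ≠ 1 := by simpa using hne 1 (by norm_num) (by norm_num)
  have hC : Subgroup.centralizer {a} = Subgroup.zpowers a :=
    centralizer_eq_zpowers (by rw [ha]; exact h a ha1)
  have hCa : Nat.card (Subgroup.centralizer {a}) = 5 := by rw [hC, Nat.card_zpowers, ha]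
  have ha2 : orderOf (a ^ 2) = 5 := orderOf_eq_prime
    (by rw [← pow_mul, mul_comm, pow_mul, ha5, one_pow]) (hne 2 (by norm_num) (by norm_num))
  have hCa2 : Nat.card (Subgroup.centralizer {a ^ 2}) = 5 := by
    rw [centralizer_eq_zpowers (by rw [ha2]; exact h _ (hne 2 (by norm_num) (by norm_num))),
      Nat.card_zpowers, ha2]
  -- Four elements with centralizer of order 5 are exactly one class, so `a` and `a ^ 2` are
  -- conjugate; the conjugating element `b` generates the complement.
  have hclass := conjClass_eq hCa (by omega)
  have hconj : IsConj a (a ^ 2) := by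
    have : a ^ 2 ∈ {y : G | Nat.card (Subgroup.centralizer {y}) = 5} := hCa2
    rwa [← hclass] at this
  obtain ⟨b, hb⟩ := isConj_iff.mp hconj
  have hbp : b ^ 2 * a * (b ^ 2)⁻¹ = a ^ 4 := by
    have : b ^ 2 * a * (b ^ 2)⁻¹ = b * (b * a * b⁻¹) * b⁻¹ := by
      rw [pow_two]
      group
    rw [this, hb, conj_pow_of_conj hb, ← pow_mul]
  have hb4a : b ^ 4 ∈ Subgroup.centralizer {a} := by
    rw [mem_centralizer_singleton]
    have h1 : b ^ 4 * a * (b ^ 4)⁻¹ = b ^ 2 * (b ^ 2 * a * (b ^ 2)⁻¹) * (b ^ 2)⁻¹ := by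
      rw [show (4 : ℕ) = 2 + 2 by norm_num, pow_add]
      group
    rw [hbp, conj_pow_of_conj hbp, ← pow_mul] at h1
    have h2 : a ^ (4 * 4) = a := by
      rw [show 4 * 4 = 5 * 3 + 1 by norm_num, pow_succ, pow_mul, ha5, one_pow, one_mul]
    rw [h2] at h1
    exact mul_inv_eq_iff_eq_mul.mp h1
  -- `b ^ 4` is a power of `a`, so conjugation by `b` squares it; but it also commutes with `b`.
  have hb4 : b ^ 4 = 1 := by
    rw [hC] at hb4a
    obtain ⟨k, hk⟩ := hb4a
    have hk : a ^ k = b ^ 4 := hk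
    have h1 : b * a ^ k * b⁻¹ = a ^ k := by
      rw [hk]
      group
    rw [← conj_zpow, hb, ← zpow_natCast, ← zpow_mul, mul_comm, zpow_mul, zpow_natCast, pow_two,
      mul_eq_left] at h1
    rw [← hk, h1]
  have hob : orderOf b = 4 := by
    refine orderOf_eq_prime_pow (p := 2) (n := 1) ?_ hb4
    intro hb2
    norm_num at hb2
    rw [hb2, one_mul, inv_one, mul_one] at hbp
    apply hne 3 (by norm_num) (by norm_num)
    rw [pow_succ] at hbp
    exact mul_eq_right.mp hbp.symm
  have hφ : ∀ x : Cyc 5, cycHom 5 a ha5 (squareAut x) = b * cycHom 5 a ha5 x * b⁻¹ := by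
    intro x
    change cycHom 5 a ha5 (x ^ 2) = b * a ^ _ * b⁻¹
    rw [conj_pow_of_conj hb, map_pow, ← pow_mul, mul_comm, pow_mul]
    rfl
  obtain ⟨h1, h2⟩ := mem_range_cyclicLift (hf := squareAut_pow_four) (cycHom 5 a ha5) b hb4 hφ
  have h1 := h1 (.ofAdd 1)
  rw [cycHom_ofAdd_one] at h1
  refine nonempty_mulEquiv_of_range_eq_top (cyclicLift (hf := squareAut_pow_four) _ b hb4 hφ) ?_ ?_
  · have h1 := dvd_card_of_mem h1 ha
    have h2 := dvd_card_of_mem h2 hob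
    apply Subgroup.eq_top_of_card_eq
    have h3 := Subgroup.card_subgroup_dvd_card
      (cyclicLift (hf := squareAut_pow_four) (cycHom 5 a ha5) b hb4 hφ).range
    rw [hG] at h3 ⊢
    have := Nat.le_of_dvd (by norm_num) h3
    have := Nat.pos_of_dvd_of_pos h3 (by norm_num)
    omega
  · rw [SemidirectProduct.card, hG]
    simp

/-- Let V be a centralizer of order 4; it is abelian and is the centralizer of each of its
nontrivial elements. The 15 elements with such centralizers form one class, so the normalizer of V
permutes the three nontrivial elements of V transitively with stabilizer V, and has order 12. -/
theorem exists_subgroup_card_eq_twelve {G : Type*} [Group G] [Finite G] (hG : Nat.card G = 60)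
    (h : ∀ x : G, x ≠ 1 → Nat.card (Subgroup.centralizer {x}) ≤ 5)
    (hcount : centralizerCount G 4 = 15) : ∃ H : Subgroup G, Nat.card H = 12 := by
  obtain ⟨x, hx⟩ : {x : G | Nat.card (Subgroup.centralizer {x}) = 4}.Nonempty := by
    rw [← Set.ncard_pos]
    change 0 < centralizerCount G 4
    omega
  have hx : Nat.card (Subgroup.centralizer {x}) = 4 := hx
  set V := Subgroup.centralizer {x} with hV
  have hcomm : IsMulCommutative V := by
    have := Fact.mk Nat.prime_two
    exact IsPGroup.isMulCommutative_of_card_eq_prime_sq (p := 2) (by rw [hx]; norm_num)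
  have hx1 : x ≠ 1 := by
    rintro rfl
    rw [hV, mem_center_iff_card_centralizer.mp (Subgroup.one_mem _)] at hx
    omega
  have hxV : x ∈ V := mem_centralizer_singleton.mpr rfl
  have hCV : ∀ y ∈ V, y ≠ 1 → Subgroup.centralizer {y} = V := by
    intro y hy hy1
    have hle : V ≤ Subgroup.centralizer {y} := by
      intro w hw
      rw [mem_centralizer_singleton]
      exact congrArg Subtype.val (hcomm.is_comm.comm (⟨w, hw⟩ : V) ⟨y, hy⟩)
    refine (Subgroup.eq_of_le_of_card_ge hle ?_).symm
    have h1 := Subgroup.card_dvd_of_le hle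
    have h2 := h y hy1
    have h3 : 0 < Nat.card (Subgroup.centralizer {y}) := Nat.card_pos
    rw [hx] at h1 ⊢
    omega
  have hclass := conjClass_eq hx (by omega)
  set N := Subgroup.normalizer (V : Set G) with hN
  have hVN : V ≤ N := Subgroup.le_normalizer
  refine ⟨N, ?_⟩
  have h1 := card_conjClass_mul_card_centralizer (⟨x, hVN hxV⟩ : N)
  have h2 : Nat.card (Subgroup.centralizer {(⟨x, hVN hxV⟩ : N)}) = 4 := by
    rw [← hx, ← Subgroup.card_map_of_injective N.subtype_injective]
    congr 2
    ext y
    simp only [Subgroup.mem_map, mem_centralizer_singleton, hV, Subgroup.subtype_apply,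
      Subtype.exists, Subtype.ext_iff, Subgroup.coe_mul]
    constructor
    · rintro ⟨z, hz, h1, rfl⟩
      exact h1
    · intro hy
      exact ⟨y, hVN (mem_centralizer_singleton.mpr hy), hy, rfl⟩
  have h3 : Set.ncard {y : N | IsConj (⟨x, hVN hxV⟩ : N) y} = 3 := by
    have h4 : Set.ncard ((V : Set G) \ {1}) = 3 := by
      have := Set.ncard_sdiff_singleton_add_one (s := (V : Set G)) V.one_mem (Set.toFinite _)
      have h5 : Set.ncard (V : Set G) = 4 := hx
      omega
    rw [← h4, ← Set.ncard_image_of_injective _ Subtype.val_injective]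
    congr 1
    ext y
    simp only [Set.mem_image, Set.mem_ofPred_eq, isConj_iff, Set.mem_sdiff, SetLike.mem_coe,
      Set.mem_singleton_iff, Subtype.exists, Subtype.ext_iff, Subgroup.coe_mul]
    constructor
    · rintro ⟨_, hz, ⟨g, hg, rfl⟩, rfl⟩
      refine ⟨(Subgroup.mem_normalizer_iff.mp hg x).mp hxV, ?_⟩
      simpa using hx1
    · rintro ⟨hyV, hy1⟩
      have : y ∈ {y : G | IsConj x y} := by
        rw [hclass]
        change Nat.card _ = 4
        rw [hCV y hyV hy1, hx]
      obtain ⟨g, hg⟩ := isConj_iff.mp this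
      refine ⟨y, hVN hyV, ⟨g, ?_, hg⟩, rfl⟩
      rw [hN, Subgroup.mem_normalizer_iff]
      intro v
      -- An element conjugating `x` to `y` carries C(x) to C(y), and both are V, so it normalizes V.
      have : g * v * g⁻¹ ∈ V ↔ g * v * g⁻¹ ∈ Subgroup.centralizer {y} := by
        rw [hCV y hyV hy1]
      change v ∈ V ↔ g * v * g⁻¹ ∈ V
      rw [this, mem_centralizer_singleton, ← hg, mem_centralizer_singleton]
      simp only [mul_assoc, inv_mul_cancel_left, mul_right_inj]
      rw [← mul_assoc, ← mul_assoc, mul_left_inj]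
  rw [h2, h3] at h1
  exact h1.symm

/-- The centreless case. -/
theorem SmallCentralizers.of_card_center_eq_one {G : Type*} [Group G] [Finite G]
    (hn : ∃ a b : G, a * b ≠ b * a) (h : SmallCentralizers G)
    (hz : Nat.card (Subgroup.center G) = 1) :
    Nonempty (G ≃* Equiv.Perm (Fin 3)) ∨ Nonempty (G ≃* alternatingGroup (Fin 4)) ∨
      Nonempty (G ≃* alternatingGroup (Fin 5)) ∨ Nonempty (G ≃* DihedralGroup 5) ∨
      Nonempty (G ≃* GA15) := by
  obtain ⟨x₀, hx₀⟩ := exists_notMem_center hn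
  have : Nontrivial G := ⟨x₀, 1, fun h => hx₀ (h ▸ Subgroup.one_mem _)⟩
  have hbot : Subgroup.center G = ⊥ := Subgroup.card_eq_one.mp hz
  have h5 : ∀ x : G, x ≠ 1 → Nat.card (Subgroup.centralizer {x}) ≤ 5 := by
    intro x hx
    have := h x (by rwa [hbot, Subgroup.mem_bot])
    omega
  have hmem : ∀ x : G, x ≠ 1 →
      Nat.card (Subgroup.centralizer {x}) ∈ ({2, 3, 4, 5} : Finset ℕ) := by
    intro x hx
    rcases h.card_cases (x := x) (by rwa [hbot, Subgroup.mem_bot]) with h | h | h | h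
    · exact h.2
    all_goals omega
  rcases card_cases_of_card_center_eq_one hmem hz with hG | hG | hG | ⟨hG, hc⟩ | ⟨hG, hc⟩ | ⟨hG, hc⟩
  · obtain ⟨b, hb⟩ := exists_prime_orderOf_dvd_card' (G := G) 2 (by rw [hG]; norm_num)
    have hb' : Nat.card (Subgroup.zpowers b) = 2 := by rw [Nat.card_zpowers, hb]
    exact Or.inl (nonempty_mulEquiv_perm (Subgroup.zpowers b)
      (normalCore_eq_bot_of_card_lt h5 _ (by omega)) (by omega) hG)
  · exact Or.inr (Or.inr (Or.inr (Or.inl (nonempty_mulEquiv_dihedralGroup_five hG h5))))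
  · obtain ⟨b, hb⟩ := exists_prime_orderOf_dvd_card' (G := G) 3 (by rw [hG]; norm_num)
    have hb' : Nat.card (Subgroup.zpowers b) = 3 := by rw [Nat.card_zpowers, hb]
    exact Or.inr (Or.inl (nonempty_mulEquiv_alternatingGroup (Subgroup.zpowers b)
      (normalCore_eq_bot_of_card_lt h5 _ (by omega)) (by omega) (by rw [hG]; rfl)))
  · exact (not_card_eq_fifteen hG h5 hc).elim
  · obtain ⟨e⟩ := nonempty_mulEquiv_C5sdC4 hG h5 hc
    obtain ⟨e₂⟩ := nonempty_GA15_mulEquiv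
    exact Or.inr (Or.inr (Or.inr (Or.inr ⟨e.trans e₂.symm⟩)))
  · obtain ⟨H, hH⟩ := exists_subgroup_card_eq_twelve hG h5 hc
    exact Or.inr (Or.inr (Or.inl (nonempty_mulEquiv_alternatingGroup H
      (normalCore_eq_bot_of_card_lt h5 _ (by omega)) (by omega) (by rw [hG]; rfl))))

/-! ### Centre of order two -/

theorem exists_pow_lt_of_mem_zpowers {G : Type*} [Group G] [Finite G] {s g : G}
    (h : g ∈ Subgroup.zpowers s) : ∃ k < orderOf s, s ^ k = g := by
  classical
  rw [mem_zpowers_iff_mem_range_orderOf] at h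
  simpa using h

/-- A nonabelian group with a cyclic subgroup of index two and order four or six is dihedral or
generalized quaternion. -/
theorem dihedral_or_quaternion {G : Type*} [Group G] [Finite G] {m : ℕ} (hm : m = 2 ∨ m = 3)
    (hG : Nat.card G = 4 * m) {s : G} (hs : orderOf s = 2 * m) (hsZ : s ∉ Subgroup.center G) :
    Nonempty (G ≃* DihedralGroup (2 * m)) ∨ Nonempty (G ≃* QuaternionGroup m) := by
  have : NeZero m := ⟨by omega⟩
  have hidx : (Subgroup.zpowers s).index = 2 := by
    have := (Subgroup.zpowers s).card_mul_index
    rw [Nat.card_zpowers, hs, hG] at this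
    rcases hm with rfl | rfl <;> omega
  obtain ⟨b, hb⟩ : ∃ b, b * s ≠ s * b := by
    by_contra! hall
    exact hsZ (Subgroup.mem_center_iff.mpr hall)
  have hbs : b ∉ Subgroup.zpowers s := by
    rintro ⟨k, rfl⟩
    exact hb ((Commute.refl s).zpow_left k)
  have htop : ∀ H : Subgroup G, s ∈ H → b ∈ H → H = ⊤ := by
    intro H h1 h2
    have hle : Subgroup.zpowers s ≤ H := by simpa using h1
    have h3 := Subgroup.card_dvd_of_le hle
    have h4 := Subgroup.card_subgroup_dvd_card H
    have h5 : Nat.card H ≠ 2 * m := by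
      intro h5
      have := Subgroup.eq_of_le_of_card_ge hle (by rw [h5, Nat.card_zpowers, hs])
      exact hbs (this ▸ h2)
    apply Subgroup.eq_top_of_card_eq
    rw [Nat.card_zpowers, hs] at h3
    rw [hG] at h4 ⊢
    have := Nat.le_of_dvd (by omega) h4
    have := Nat.pos_of_dvd_of_pos h4 (by omega)
    rcases hm with rfl | rfl <;> omega
  have hconj : b * s * b⁻¹ = s⁻¹ := by
    have hN := Subgroup.normal_of_index_eq_two hidx
    obtain ⟨k, hk, hks⟩ := exists_pow_lt_of_mem_zpowers (hN.conj_mem s (Subgroup.mem_zpowers s) b)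
    have h1 : orderOf (s ^ k) = 2 * m := by
      rw [hks, ← hs]
      exact orderOf_injective (MulAut.conj b).toMonoidHom (MulAut.conj b).injective s
    rw [orderOf_pow, hs] at h1
    rw [hs] at hk
    -- For m = 2 or 3 the only exponents coprime to 2m are 1 and -1 modulo 2m, so `b` either
    -- centralizes or inverts `s`.
    have h2 : k = 1 ∨ k + 1 = 2 * m := by
      rcases hm with rfl | rfl <;> interval_cases k <;> simp_all
    rcases h2 with rfl | h2
    · rw [pow_one] at hks
      exact (hb (mul_inv_eq_iff_eq_mul.mp hks.symm)).elim
    · rw [← hks, eq_inv_iff_mul_eq_one, ← pow_succ, h2, ← hs, pow_orderOf_eq_one]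
  have hb2 : b ^ 2 ∈ Subgroup.zpowers s := Subgroup.sq_mem_of_index_two hidx b
  obtain ⟨k, hk, hkb⟩ := exists_pow_lt_of_mem_zpowers hb2
  -- `b ^ 2 = s ^ k` is fixed by conjugation with `b` yet inverted by it, so 2m divides 2k. The two
  -- values separate the dihedral from the quaternion case.
  have hkm : k = 0 ∨ k = m := by
    have h1 : b * s ^ k * b⁻¹ = s ^ k := by
      rw [hkb]
      group
    rw [conj_pow_of_conj hconj, inv_pow, inv_eq_iff_mul_eq_one, ← pow_add,
      ← orderOf_dvd_iff_pow_eq_one] at h1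
    rw [hs] at h1 hk
    obtain ⟨j, hj⟩ := h1
    have : j < 2 := by
      by_contra! hj2
      have := Nat.mul_le_mul_left (2 * m) hj2
      omega
    interval_cases j <;> omega
  have hs1 : s ^ (2 * m) = 1 := by rw [← orderOf_dvd_iff_pow_eq_one, hs]
  rcases hkm with rfl | rfl
  · left
    rw [pow_zero] at hkb
    obtain ⟨h1, h2⟩ := mem_range_dihedralLift (2 * m) s b hs1 hkb.symm hconj
    exact nonempty_mulEquiv_of_range_eq_top _ (htop _ h1 h2)
      (by rw [hG, DihedralGroup.nat_card]; ring)
  · right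
    obtain ⟨h1, h2⟩ := mem_range_quaternionLift k s b hs1 hkb.symm hconj
    exact nonempty_mulEquiv_of_range_eq_top _ (htop _ h1 h2)
      (by rw [hG, Nat.card_eq_fintype_card, QuaternionGroup.card])

theorem nonempty_mulEquiv_C3sdC4 : Nonempty (QuaternionGroup 3 ≃* C3sdC4) := by
  -- The generator of order six is the generator of C₃ times the central involution, the square of
  -- the generator of C₄.
  let f : QuaternionGroup 3 →* C3sdC4 := quaternionLift 3
    (SemidirectProduct.inl (.ofAdd 1) * SemidirectProduct.inr (.ofAdd 2))
    (SemidirectProduct.inr (.ofAdd 1)) (by decide) (by decide) (by decide)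
  refine ⟨MulEquiv.ofBijective f ((Nat.bijective_iff_injective_and_card f).mpr ⟨?_, ?_⟩)⟩
  · rw [injective_iff_map_eq_one]
    decide +kernel
  · rw [SemidirectProduct.card, Nat.card_eq_fintype_card, QuaternionGroup.card]
    simp

theorem exists_orderOf_eq_four {G : Type*} [Group G] [Finite G] (hG : Nat.card G = 8)
    (hn : ∃ a b : G, a * b ≠ b * a) : ∃ s : G, orderOf s = 4 := by
  obtain ⟨a, b, hab⟩ := hn
  have h2 : ∃ s : G, s ^ 2 ≠ 1 := by
    by_contra! hall
    exact hab (Commute.of_orderOf_dvd_two (fun g => orderOf_dvd_of_pow_eq_one (hall g)) a b)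
  obtain ⟨s, hs⟩ := h2
  have h1 : orderOf s ∣ 2 ^ 3 := by
    have := orderOf_dvd_natCard s
    rwa [hG] at this
  obtain ⟨k, hk, hk'⟩ := (Nat.dvd_prime_pow Nat.prime_two).mp h1
  refine ⟨s, ?_⟩
  have h4 : k ≠ 3 := by
    rintro rfl
    have : IsCyclic G := isCyclic_of_orderOf_eq_card s (by rw [hk', hG]; norm_num)
    exact hab ((IsCyclic.isMulCommutative (α := G)).is_comm.comm a b)
  have h5 : k ≠ 0 := by
    rintro rfl
    apply hs
    rw [orderOf_eq_one_iff.mp hk', one_pow]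
  have h6 : k ≠ 1 := by
    rintro rfl
    exact hs (by rw [← orderOf_dvd_iff_pow_eq_one, hk']; norm_num)
  have : k = 2 := by omega
  rw [hk', this]
  norm_num

theorem exists_orderOf_eq_six {G : Type*} [Group G] [Finite G] {c h : G} (hc : orderOf c = 2)
    (hcZ : c ∈ Subgroup.center G) (hh : orderOf h = 3) : orderOf (h * c) = 6 := by
  have h1 : Commute h c := Subgroup.mem_center_iff.mp hcZ h
  rw [h1.orderOf_mul_eq_mul_orderOf_of_coprime (by rw [hc, hh]; norm_num), hc, hh]

theorem exists_center_orderOf_eq_two {G : Type*} [Group G] [Finite G]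
    (hz : Nat.card (Subgroup.center G) = 2) :
    ∃ c ∈ Subgroup.center G, orderOf c = 2 ∧ ∀ z ∈ Subgroup.center G, z = 1 ∨ z = c := by
  obtain ⟨⟨c, hcZ⟩, hc⟩ := exists_prime_orderOf_dvd_card' (G := Subgroup.center G) 2 (by rw [hz])
  rw [Subgroup.orderOf_mk] at hc
  refine ⟨c, hcZ, hc, fun z hz' => ?_⟩
  have he : Subgroup.zpowers c = Subgroup.center G :=
    Subgroup.eq_of_le_of_card_ge (by simpa using hcZ) (by rw [Nat.card_zpowers, hc, hz])
  rw [← he] at hz'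
  obtain ⟨k, hk, rfl⟩ := exists_pow_lt_of_mem_zpowers hz'
  rw [hc] at hk
  interval_cases k <;> simp

theorem commute_of_commute_sq {G : Type*} [Group G] {h x : G} (hh : h ^ 3 = 1)
    (hx : Commute (h ^ 2) x) : Commute h x := by
  have h1 : (h ^ 2) ^ 2 = h := by
    rw [← pow_mul, show 2 * 2 = 3 + 1 by norm_num, pow_succ, hh, one_mul]
  rw [← h1]
  exact hx.pow_left 2

/-- The six elements with centralizer of order 4, together with the centre, form a Sylow 2-subgroup.
They all square to the central involution `c` and invert one another unless they commute, as in Q₈;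
an element of order three then acts on them without fixed points. -/
theorem nonempty_mulEquiv_Q8sdC3_of_center {G : Type*} [Group G] [Finite G]
    (hG : Nat.card G = 24) (hz : Nat.card (Subgroup.center G) = 2)
    (hC : ∀ x : G, x ∉ Subgroup.center G →
      Nat.card (Subgroup.centralizer {x}) = 4 ∨ Nat.card (Subgroup.centralizer {x}) = 6)
    (hcount : 4 < centralizerCount G 6 → centralizerCount G 4 = 6) :
    Nonempty (G ≃* Q8sdC3) := by
  obtain ⟨c, hcZ, hc, hZ⟩ := exists_center_orderOf_eq_two hz
  have hc2 : c ^ 2 = 1 := by rw [← orderOf_dvd_iff_pow_eq_one, hc]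
  have hcomm : ∀ g, g * c = c * g := Subgroup.mem_center_iff.mp hcZ
  have hC3 : ∀ h : G, orderOf h = 3 → Subgroup.centralizer {h} = Subgroup.zpowers (h * c) := by
    intro h hh
    have h6 := exists_orderOf_eq_six hc hcZ hh
    have hle : Subgroup.zpowers (h * c) ≤ Subgroup.centralizer {h} := by
      rw [Subgroup.zpowers_le, mem_centralizer_singleton, mul_assoc, ← hcomm h]
    have h1 : h ∉ Subgroup.center G := by
      intro h1
      rcases hZ h h1 with rfl | rfl
      · simp at hh
      · omega
    refine (Subgroup.eq_of_le_of_card_ge hle ?_).symm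
    have h2 := Subgroup.card_dvd_of_le hle
    rw [Nat.card_zpowers, h6] at h2 ⊢
    rcases hC h h1 with h | h <;> omega
  obtain ⟨h, hh⟩ := exists_prime_orderOf_dvd_card' (G := G) 3 (by rw [hG]; norm_num)
  have hh3 : h ^ 3 = 1 := by rw [← orderOf_dvd_iff_pow_eq_one, hh]
  have hCh : Nat.card (Subgroup.centralizer {h}) = 6 := by
    rw [hC3 h hh, Nat.card_zpowers, exists_orderOf_eq_six hc hcZ hh]
  -- The class of `h` has four elements; `h * c` has the same centralizer but order six, so it is a
  -- fifth element with centralizer of order 6.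
  have hn4 : Set.ncard {x : G | Nat.card (Subgroup.centralizer {x}) = 4} = 6 := by
    apply hcount
    have h1 := card_conjClass_mul_card_centralizer h
    rw [hCh, hG] at h1
    have h2 : h * c ∉ {y : G | IsConj h y} := by
      intro h2
      obtain ⟨g, hg⟩ := isConj_iff.mp h2
      have := orderOf_injective (MulAut.conj g).toMonoidHom (MulAut.conj g).injective h
      simp only [MulEquiv.coe_toMonoidHom, MulAut.conj_apply] at this
      rw [hg, exists_orderOf_eq_six hc hcZ hh, hh] at this
      omega
    have h3 : insert (h * c) {y : G | IsConj h y} ⊆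
        {x : G | Nat.card (Subgroup.centralizer {x}) = 6} := by
      rintro y (rfl | hy)
      · have h4 : Subgroup.centralizer {h * c} = Subgroup.centralizer {h} := by
          ext g
          rw [mem_centralizer_singleton, mem_centralizer_singleton, ← mul_assoc, mul_assoc h c g,
            ← hcomm g, ← mul_assoc, mul_left_inj]
        change Nat.card _ = 6
        rw [h4, hCh]
      · exact (card_centralizer_of_isConj hy).symm.trans hCh
    have h4 := Set.ncard_le_ncard h3 (Set.toFinite _)
    rw [Set.ncard_insert_of_notMem h2 (Set.toFinite _)] at h4
    change 4 < Set.ncard _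
    omega
  have h3C : ∀ x : G, Nat.card (Subgroup.centralizer {x}) = 4 → ¬ Commute h x := by
    intro x hx hcx
    have := dvd_card_of_mem (mem_centralizer_singleton.mpr hcx.eq) hh
    omega
  have := Fact.mk Nat.prime_two
  obtain ⟨P, hP⟩ := Sylow.exists_subgroup_card_pow_prime 2 (n := 3) (G := G)
    (by rw [hG]; norm_num)
  -- A noncentral `x` in `P` with |C(x)| = 6 would have order dividing gcd(8, 6) and lie in a cyclic
  -- group of order six whose only involution is `c`. So one inclusion holds, and 8 = 2 + 6 makes it
  -- an equality.
  have hPset : (P : Set G) = (Subgroup.center G : Set G) ∪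
      {x : G | Nat.card (Subgroup.centralizer {x}) = 4} := by
    refine Set.eq_of_subset_of_ncard_le ?_ ?_ (Set.toFinite _)
    · intro x hx
      by_cases hxZ : x ∈ Subgroup.center G
      · exact Or.inl hxZ
      · refine Or.inr ((hC x hxZ).resolve_right fun h6 => hxZ ?_)
        obtain ⟨⟨g, hg⟩, hgo⟩ :=
          exists_prime_orderOf_dvd_card' (G := Subgroup.centralizer {x}) 3 (by rw [h6]; norm_num)
        rw [Subgroup.orderOf_mk] at hgo
        have hx8 : orderOf x ∣ 8 := by
          have := dvd_card_of_mem (H := P) hx rfl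
          rwa [hP] at this
        have hx6 : orderOf x ∣ 6 := by
          rw [← h6]
          exact dvd_card_of_mem (mem_centralizer_singleton.mpr rfl) rfl
        have hx2 : orderOf x ∣ 2 := by simpa using Nat.dvd_gcd hx8 hx6
        have hxg : x ∈ Subgroup.centralizer {g} :=
          mem_centralizer_singleton.mpr (mem_centralizer_singleton.mp hg).symm
        rw [hC3 g hgo] at hxg
        obtain ⟨k, hk, rfl⟩ := exists_pow_lt_of_mem_zpowers hxg
        have h6g := exists_orderOf_eq_six hc hcZ hgo
        rw [orderOf_dvd_iff_pow_eq_one, ← pow_mul, ← orderOf_dvd_iff_pow_eq_one, h6g] at hx2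
        rw [h6g] at hk
        have hgc : Commute g c := hcomm g
        have hk3 : k = 0 ∨ k = 3 := by omega
        rcases hk3 with rfl | rfl
        · simp
        · have hg3 : g ^ 3 = 1 := by rw [← orderOf_dvd_iff_pow_eq_one, hgo]
          rw [hgc.mul_pow, hg3, one_mul]
          exact Subgroup.pow_mem _ hcZ 3
    · refine (Set.ncard_union_le _ _).trans ?_
      have h1 : Set.ncard (Subgroup.center G : Set G) = 2 := hz
      have h2 : Set.ncard (P : Set G) = 2 ^ 3 := hP
      omega
  have hPiff : ∀ x, x ∈ P ↔ x ∈ Subgroup.center G ∨ Nat.card (Subgroup.centralizer {x}) = 4 := by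
    intro x
    rw [← SetLike.mem_coe, hPset]
    rfl
  have hS4 : ∀ x : G, Nat.card (Subgroup.centralizer {x}) = 4 → x ∉ Subgroup.center G := by
    intro x hx hxZ
    rw [mem_center_iff_card_centralizer.mp hxZ, hG] at hx
    omega
  have hconj4 : ∀ x y : G, Nat.card (Subgroup.centralizer {x}) = 4 →
      Nat.card (Subgroup.centralizer {y}) = 4 → IsConj x y := by
    intro x y hx hy
    have := conjClass_eq hx (by
      change Set.ncard _ * 4 ≤ _
      omega)
    have h1 : y ∈ {y : G | Nat.card (Subgroup.centralizer {y}) = 4} := hy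
    rwa [← this] at h1
  obtain ⟨x, hx⟩ : {x : G | Nat.card (Subgroup.centralizer {x}) = 4}.Nonempty := by
    rw [← Set.ncard_pos, hn4]
    norm_num
  have hx : Nat.card (Subgroup.centralizer {x}) = 4 := hx
  -- If one of these conjugate elements squares to 1, all do, so `P` has exponent two and is
  -- abelian, contradicting |C(x)| = 4.
  have hsq1 : ∀ y : G, Nat.card (Subgroup.centralizer {y}) = 4 → y ^ 2 ≠ 1 := by
    intro y hy hy2
    have hall : ∀ w ∈ P, w ^ 2 = 1 := by
      intro w hw
      rcases (hPiff w).mp hw with hw | hw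
      · rcases hZ w hw with rfl | rfl
        · simp
        · exact hc2
      · obtain ⟨g, rfl⟩ := isConj_iff.mp (hconj4 y w hy hw)
        rw [conj_pow, hy2]
        group
    have hle : P ≤ Subgroup.centralizer {x} := by
      intro w hw
      rw [mem_centralizer_singleton]
      have hP2 : ∀ u : P, orderOf u ∣ 2 := fun u =>
        orderOf_dvd_of_pow_eq_one (Subtype.ext (hall u u.2))
      exact congrArg Subtype.val
        (Commute.of_orderOf_dvd_two hP2 ⟨w, hw⟩ ⟨x, (hPiff x).mpr (Or.inr hx)⟩).eq
    have := Subgroup.card_dvd_of_le hle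
    rw [hP, hx] at this
    norm_num at this
  have hsq : ∀ y : G, Nat.card (Subgroup.centralizer {y}) = 4 → y ^ 2 = c := by
    intro y hy
    rcases (hPiff (y ^ 2)).mp (P.pow_mem ((hPiff y).mpr (Or.inr hy)) 2) with h1 | h1
    · exact (hZ _ h1).resolve_left (hsq1 y hy)
    · exfalso
      apply hsq1 _ h1
      rw [← pow_mul, ← orderOf_dvd_iff_pow_eq_one, show 2 * 2 = 4 from rfl, ← hy]
      exact dvd_card_of_mem (mem_centralizer_singleton.mpr rfl) rfl
  have hord : ∀ y : G, Nat.card (Subgroup.centralizer {y}) = 4 → orderOf y = 4 := by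
    intro y hy
    refine orderOf_eq_prime_pow (p := 2) (n := 1) (by simpa using hsq1 y hy) ?_
    rw [show 2 ^ (1 + 1) = 2 * 2 by norm_num, pow_mul, hsq y hy, hc2]
  have hCz : ∀ y : G, Nat.card (Subgroup.centralizer {y}) = 4 →
      ∀ g, Commute g y → g ∉ Subgroup.center G → g = y ∨ g = y⁻¹ := by
    intro y hy g hg hgZ
    have h1 : g ∈ Subgroup.centralizer {y} := mem_centralizer_singleton.mpr hg.eq
    rw [centralizer_eq_zpowers (by rw [hy, hord y hy])] at h1
    obtain ⟨k, hk, rfl⟩ := exists_pow_lt_of_mem_zpowers h1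
    rw [hord y hy] at hk
    interval_cases k
    · simp at hgZ
    · simp
    · exact (hgZ (hsq y hy ▸ hcZ)).elim
    · right
      rw [eq_inv_iff_mul_eq_one, ← pow_succ, ← orderOf_dvd_iff_pow_eq_one, hord y hy]
  -- The product `x * y` is again noncentral in `P`, so (xy)² = c = y², that is, xyx = y.
  have hinv : ∀ x y : G, Nat.card (Subgroup.centralizer {x}) = 4 →
      Nat.card (Subgroup.centralizer {y}) = 4 → ¬ Commute y x → y * x * y⁻¹ = x⁻¹ := by
    intro x y hx hy hxy
    have h1 : Nat.card (Subgroup.centralizer {x * y}) = 4 := by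
      refine ((hPiff _).mp (P.mul_mem ((hPiff x).mpr (Or.inr hx))
        ((hPiff y).mpr (Or.inr hy)))).resolve_left fun h1 => hxy ?_
      have h2 := Subgroup.mem_center_iff.mp h1 x
      rw [mul_assoc, mul_right_inj] at h2
      exact h2.symm
    have h2 := hsq _ h1
    have h3 := hsq y hy
    rw [mul_inv_eq_iff_eq_mul, eq_inv_mul_iff_mul_eq]
    have h4 : x * (y * x) * y = y * y := by
      rw [← pow_two y, h3, ← h2, pow_two]
      group
    exact mul_right_cancel h4
  have hconjC : ∀ g y : G, Nat.card (Subgroup.centralizer {y}) = 4 →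
      Nat.card (Subgroup.centralizer {g * y * g⁻¹}) = 4 := by
    intro g y hy
    rw [← hy]
    exact (card_centralizer_of_isConj (isConj_iff.mpr ⟨g, rfl⟩)).symm
  -- If the conjugate commutes with `y`, it is `y` or `y⁻¹`; in the second case `g ^ 2` commutes
  -- with `y`, and so does `g`, its fourth power being itself.
  have hnc : ∀ g : G, g ^ 3 = 1 → (∀ y : G, Nat.card (Subgroup.centralizer {y}) = 4 →
      ¬ Commute g y) → ∀ y : G, Nat.card (Subgroup.centralizer {y}) = 4 →
      ¬ Commute (g * y * g⁻¹) y := by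
    intro g hg3 hg y hy hcom
    rcases hCz y hy _ hcom (hS4 _ (hconjC g y hy)) with h1 | h1
    · exact hg y hy (mul_inv_eq_iff_eq_mul.mp h1)
    · apply hg y hy
      apply commute_of_commute_sq hg3
      have h2 : g ^ 2 * y * (g ^ 2)⁻¹ = g * (g * y * g⁻¹) * g⁻¹ := by
        rw [pow_two]
        group
      rw [h1, ← conj_inv, h1, inv_inv] at h2
      exact mul_inv_eq_iff_eq_mul.mp h2
  have hh3' : (h ^ 2) ^ 3 = 1 := by rw [← pow_mul, mul_comm, pow_mul, hh3, one_pow]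
  set y := h * x * h⁻¹ with hy_def
  set w := h * y * h⁻¹ with hw_def
  have hy : Nat.card (Subgroup.centralizer {y}) = 4 := hconjC h x hx
  have hw : Nat.card (Subgroup.centralizer {w}) = 4 := hconjC h y hy
  have hyx : ¬ Commute y x := hnc h hh3 h3C x hx
  have hwy : ¬ Commute w y := hnc h hh3 h3C y hy
  have hwx : ¬ Commute w x := by
    have h1 := hnc (h ^ 2) hh3' (fun y hy hcy => h3C y hy (commute_of_commute_sq hh3 hcy)) x hx
    convert h1 using 1
    rw [hw_def, hy_def, pow_two]
    group
  have hyxi := hinv x y hx hy hyx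
  have hwxi := hinv x w hx hw hwx
  -- Both `y` and `w` invert `x`, so `y⁻¹ * w` is `x` or `x⁻¹`. In the first case the relations of
  -- the model hold for `x⁻¹` and `y⁻¹` instead.
  have hyw : Commute (y⁻¹ * w) x := by
    rw [← hyxi, mul_inv_eq_iff_eq_mul] at hwxi
    change y⁻¹ * w * x = x * (y⁻¹ * w)
    rw [mul_assoc, hwxi]
    group
  have hywZ : y⁻¹ * w ∉ Subgroup.center G := by
    intro hcen
    apply hwy
    have h2 := Subgroup.mem_center_iff.mp hcen y
    rw [mul_inv_cancel_left] at h2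
    change w * y = y * w
    conv_rhs => rw [h2]
    group
  rcases hCz x hx _ hyw hywZ with h1 | h1
  · refine nonempty_mulEquiv_Q8sdC3 hG (x := x⁻¹) (y := y⁻¹) (h := h) ?_ ?_ ?_ hh ?_ ?_
    · rw [orderOf_inv, hord x hx]
    · rw [inv_pow, inv_pow, hsq x hx, hsq y hy]
    · rw [inv_inv, inv_inv, ← hyxi]
      group
    · rw [← conj_inv]
    · rw [← conj_inv, ← hw_def, ← mul_inv_rev, ← h1, mul_inv_cancel_left]
  · refine nonempty_mulEquiv_Q8sdC3 hG (x := x) (y := y) (h := h) (hord x hx) ?_ hyxi hh rfl ?_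
    · rw [hsq x hx, hsq y hy]
    · have h2 : y * x⁻¹ * y⁻¹ = x := by rw [← conj_inv, hyxi, inv_inv]
      have h3 : w = y * x⁻¹ := by rw [← h1, mul_inv_cancel_left]
      rw [← hw_def, h3]
      exact mul_inv_eq_iff_eq_mul.mp h2

/-- The case of a centre of order two. -/
theorem SmallCentralizers.of_card_center_eq_two {G : Type*} [Group G] [Finite G]
    (hn : ∃ a b : G, a * b ≠ b * a) (h : SmallCentralizers G)
    (hz : Nat.card (Subgroup.center G) = 2) :
    Nonempty (G ≃* DihedralGroup 4) ∨ Nonempty (G ≃* QuaternionGroup 2) ∨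
      Nonempty (G ≃* DihedralGroup 6) ∨ Nonempty (G ≃* C3sdC4) ∨
      Nonempty (G ≃* Matrix.SpecialLinearGroup (Fin 2) (ZMod 3)) := by
  have hmem : ∀ x : G, x ∉ Subgroup.center G →
      Nat.card (Subgroup.centralizer {x}) ∈ ({4, 6} : Finset ℕ) := by
    intro x hx
    rcases h.card_cases hx with h | h | h | h
    · omega
    · exact h.2
    all_goals omega
  have hnot : ∀ s : G, orderOf s ≠ 1 → orderOf s ≠ 2 → s ∉ Subgroup.center G := by
    intro s h1 h2 hs
    have := dvd_card_of_mem hs rfl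
    rw [hz, Nat.dvd_prime Nat.prime_two] at this
    omega
  rcases card_cases_of_card_center_eq_two hn hmem hz with hG | hG | ⟨hG, hc⟩
  · obtain ⟨s, hs⟩ := exists_orderOf_eq_four hG hn
    rcases dihedral_or_quaternion (m := 2) (Or.inl rfl) hG hs
      (hnot s (by omega) (by omega)) with h | h
    · exact Or.inl h
    · exact Or.inr (Or.inl h)
  · obtain ⟨c, hcZ, hc, -⟩ := exists_center_orderOf_eq_two hz
    obtain ⟨a, ha⟩ := exists_prime_orderOf_dvd_card' (G := G) 3 (by rw [hG]; norm_num)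
    have hs := exists_orderOf_eq_six hc hcZ ha
    rcases dihedral_or_quaternion (m := 3) (Or.inr rfl) hG hs
      (hnot _ (by omega) (by omega)) with h | h
    · exact Or.inr (Or.inr (Or.inl h))
    · obtain ⟨e⟩ := h
      obtain ⟨e₂⟩ := nonempty_mulEquiv_C3sdC4
      exact Or.inr (Or.inr (Or.inr (Or.inl ⟨e.trans e₂⟩)))
  · obtain ⟨e⟩ := nonempty_mulEquiv_Q8sdC3_of_center hG hz (by simpa using hmem) hc
    obtain ⟨e₂⟩ := nonempty_specialLinearGroup_mulEquiv_Q8sdC3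
    exact Or.inr (Or.inr (Or.inr (Or.inr ⟨e.trans e₂.symm⟩)))

/-! ### Centre of order four: commutator calculus -/

section CommutatorCalculus

open scoped commutatorElement

section CentralCommutators

variable {G : Type*} [Group G]

theorem commutator_mul_right_of_central (hcen : ∀ x y : G, ⁅x, y⁆ ∈ Subgroup.center G)
    (x g h : G) : ⁅x, g * h⁆ = ⁅x, g⁆ * ⁅x, h⁆ := by
  have h1 := Subgroup.mem_center_iff.mp (hcen x h) g
  have h2 : ⁅x, g * h⁆ = ⁅x, g⁆ * (g * ⁅x, h⁆) * g⁻¹ := by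
    simp only [commutatorElement_def]
    group
  rw [h2, h1]
  group

theorem commutator_mul_left_of_central (hcen : ∀ x y : G, ⁅x, y⁆ ∈ Subgroup.center G)
    (x y g : G) : ⁅x * y, g⁆ = ⁅x, g⁆ * ⁅y, g⁆ := by
  rw [← inv_inj, commutatorElement_inv, commutator_mul_right_of_central hcen, mul_inv_rev,
    commutatorElement_inv, commutatorElement_inv]
  exact (Subgroup.mem_center_iff.mp (hcen g x) _).symm

theorem commutator_of_mem_center {z : G} (hz : z ∈ Subgroup.center G) (x : G) : ⁅x, z⁆ = 1 :=
  commutatorElement_eq_one_iff_commute.mpr (Subgroup.mem_center_iff.mp hz x)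

theorem commutator_mem_center_of_sq_mem (hsq : ∀ x : G, x ^ 2 ∈ Subgroup.center G) (x y : G) :
    ⁅x, y⁆ ∈ Subgroup.center G := by
  -- A commutator is a product of conjugates of squares and their inverses.
  have h1 : ⁅x, y⁆ = (x * y) ^ 2 * (y⁻¹ * (x ^ 2)⁻¹ * y) * (y ^ 2)⁻¹ := by
    simp only [commutatorElement_def, pow_two]
    group
  have h2 : y⁻¹ * (x ^ 2)⁻¹ * y = (x ^ 2)⁻¹ := by
    rw [mul_assoc, ← Subgroup.mem_center_iff.mp (Subgroup.inv_mem _ (hsq x)) y,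
      inv_mul_cancel_left]
  rw [h1, h2]
  exact Subgroup.mul_mem _ (Subgroup.mul_mem _ (hsq _) (Subgroup.inv_mem _ (hsq x)))
    (Subgroup.inv_mem _ (hsq y))

theorem commutator_sq_of_sq_mem (hsq : ∀ x : G, x ^ 2 ∈ Subgroup.center G) (x y : G) :
    ⁅x, y⁆ ^ 2 = 1 := by
  have hcen := commutator_mem_center_of_sq_mem hsq
  rw [pow_two, ← commutator_mul_right_of_central hcen, ← pow_two]
  exact commutator_of_mem_center (hsq y) x

theorem mul_sq_of_sq_mem (hsq : ∀ x : G, x ^ 2 ∈ Subgroup.center G) (x y : G) :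
    (x * y) ^ 2 = ⁅x, y⁆ * x ^ 2 * y ^ 2 := by
  have h1 : (x * y) ^ 2 = ⁅x, y⁆ * (y * x ^ 2) * y := by
    simp only [commutatorElement_def, pow_two]
    group
  rw [h1, Subgroup.mem_center_iff.mp (hsq x) y, pow_two y]
  group

theorem commutator_comm_of_sq_mem (hsq : ∀ x : G, x ^ 2 ∈ Subgroup.center G) (x y : G) :
    ⁅x, y⁆ = ⁅y, x⁆ := by
  rw [← commutatorElement_inv, inv_eq_iff_mul_eq_one.mpr]
  rw [← pow_two, commutator_sq_of_sq_mem hsq]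

theorem conj_eq_commutator_mul (x y : G) : x * y * x⁻¹ = ⁅x, y⁆ * y := by
  simp [commutatorElement_def]

end CentralCommutators

/-- The centre has index two in C(x), so two elements of C(x) outside the centre have central
product. -/
theorem mul_mem_center_of_commute {G : Type*} [Group G] [Finite G] {x g : G}
    (hx : Nat.card (Subgroup.centralizer {x}) = 2 * Nat.card (Subgroup.center G))
    (hxZ : x ∉ Subgroup.center G) (hg : Commute g x) (hgZ : g ∉ Subgroup.center G) :
    x * g ∈ Subgroup.center G := by
  have hidx : ((Subgroup.center G).subgroupOf (Subgroup.centralizer {x})).index = 2 := by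
    have h1 := ((Subgroup.center G).subgroupOf (Subgroup.centralizer {x})).card_mul_index
    have h2 : Nat.card ((Subgroup.center G).subgroupOf (Subgroup.centralizer {x})) =
        Nat.card (Subgroup.center G) :=
      Nat.card_congr (Subgroup.subgroupOfEquivOfLe (Subgroup.center_le_centralizer _)).toEquiv
    rw [h2, hx, mul_comm] at h1
    exact Nat.eq_of_mul_eq_mul_right Nat.card_pos h1
  have := Subgroup.mul_mem_iff_of_index_two hidx
    (a := ⟨x, mem_centralizer_singleton.mpr rfl⟩) (b := ⟨g, mem_centralizer_singleton.mpr hg.eq⟩)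
  simp only [Subgroup.mem_subgroupOf, Subgroup.coe_mul] at this
  exact this.mpr (by simp [hxZ, hgZ])

theorem sq_mem_center_of_card_centralizer {G : Type*} [Group G] [Finite G]
    (hC : ∀ x : G, x ∉ Subgroup.center G →
      Nat.card (Subgroup.centralizer {x}) = 2 * Nat.card (Subgroup.center G)) (x : G) :
    x ^ 2 ∈ Subgroup.center G := by
  by_cases hx : x ∈ Subgroup.center G
  · exact Subgroup.pow_mem _ hx 2
  · rw [pow_two]
    exact mul_mem_center_of_commute (hC x hx) hx (Commute.refl x) hx

theorem mem_center_cases {G : Type*} [Group G] [Finite G]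
    (hz : Nat.card (Subgroup.center G) = 4) {c d : G} (hc : c ∈ Subgroup.center G)
    (hd : d ∈ Subgroup.center G) (hc1 : c ≠ 1) (hd1 : d ≠ 1) (hcd : d ≠ c) (hc2 : c ^ 2 = 1)
    {z : G} (hzZ : z ∈ Subgroup.center G) : z = 1 ∨ z = c ∨ z = d ∨ z = c * d := by
  classical
  have h1 : ((({1, c, d, c * d} : Finset G) : Set G)) = (Subgroup.center G : Set G) := by
    refine Set.eq_of_subset_of_ncard_le ?_ ?_ (Set.toFinite _)
    · intro w hw
      simp only [Finset.coe_insert, Finset.coe_singleton, Set.mem_insert_iff,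
        Set.mem_singleton_iff] at hw
      rcases hw with rfl | rfl | rfl | rfl
      · exact Subgroup.one_mem _
      · exact hc
      · exact hd
      · exact Subgroup.mul_mem _ hc hd
    · have h2 : Set.ncard (Subgroup.center G : Set G) = 4 := hz
      have h3 : c * d ≠ 1 := fun h => hcd (by
        rw [← mul_right_inj c, h, ← pow_two, hc2])
      rw [h2, Set.ncard_coe_finset, Finset.card_insert_of_notMem, Finset.card_insert_of_notMem,
        Finset.card_pair]
      · simpa using hc1
      · simp [hcd.symm, hd1]
      · simp [hc1.symm, hd1.symm, h3.symm]
  have h2 : z ∈ (({1, c, d, c * d} : Finset G) : Set G) := h1 ▸ hzZ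
  simpa using h2

theorem exists_mem_center_ne {G : Type*} [Group G] [Finite G]
    (hz : Nat.card (Subgroup.center G) = 4) (c : G) :
    ∃ d ∈ Subgroup.center G, d ≠ 1 ∧ d ≠ c := by
  by_contra! hall
  have h1 : (Subgroup.center G : Set G) ⊆ {1, c} := by
    intro w hw
    by_cases hw1 : w = 1
    · exact Or.inl hw1
    · exact Or.inr (hall w hw hw1)
  have h2 := Set.ncard_le_ncard h1 (Set.toFinite _)
  have h3 : Set.ncard (Subgroup.center G : Set G) = 4 := hz
  have h4 := Set.ncard_insert_le 1 ({c} : Set G)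
  rw [Set.ncard_singleton] at h4
  omega

/-- The commutator induces an alternating map from G/Z ≅ 𝔽₂³ to Z. Its extension to the exterior
square, of dimension three, has a kernel because Z has order four, and every bivector in dimension
three is decomposable. So two elements independent modulo Z commute, contradicting |C(x)| = 2|Z|. -/
theorem not_card_eq_thirtyTwo {G : Type*} [Group G] [Finite G] (hn : ∃ a b : G, a * b ≠ b * a)
    (hG : Nat.card G = 32) (hz : Nat.card (Subgroup.center G) = 4)
    (hC : ∀ x : G, x ∉ Subgroup.center G → Nat.card (Subgroup.centralizer {x}) = 8) : False := by
  have hC' : ∀ x : G, x ∉ Subgroup.center G →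
      Nat.card (Subgroup.centralizer {x}) = 2 * Nat.card (Subgroup.center G) := by
    intro x hx
    rw [hC x hx, hz]
  have hsq := sq_mem_center_of_card_centralizer hC'
  have hcen := commutator_mem_center_of_sq_mem hsq
  have hR := commutator_mul_right_of_central hcen
  have hL := commutator_mul_left_of_central hcen
  obtain ⟨x, y, hxy⟩ := hn
  set c := ⁅x, y⁆ with hc
  have hc1 : c ≠ 1 := fun h => hxy (commutatorElement_eq_one_iff_commute.mp h).eq
  have hcc : c * c = 1 := by rw [← pow_two, commutator_sq_of_sq_mem hsq]
  have hxZ : x ∉ Subgroup.center G := fun h => hxy (Subgroup.mem_center_iff.mp h y).symm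
  have hyZ : y ∉ Subgroup.center G := fun h => hxy (Subgroup.mem_center_iff.mp h x)
  obtain ⟨d, hdZ, hd1, hdc⟩ := exists_mem_center_ne hz c
  -- The class of `x` has four elements and lies in the coset Zx, so it fills it: every central
  -- element is a commutator with `x`.
  obtain ⟨u, hu⟩ : ∃ u, ⁅x, u⁆ = d := by
    have h1 : {w : G | IsConj x w} = (fun z => z * x) '' (Subgroup.center G : Set G) := by
      refine Set.eq_of_subset_of_ncard_le ?_ ?_ (Set.toFinite _)
      · intro w hw
        obtain ⟨g, rfl⟩ := isConj_iff.mp hw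
        exact ⟨⁅g, x⁆, hcen g x, (conj_eq_commutator_mul g x).symm⟩
      · rw [Set.ncard_image_of_injective _ (mul_left_injective x)]
        have h2 := card_conjClass_mul_card_centralizer x
        rw [hC x hxZ, hG] at h2
        have h3 : Set.ncard (Subgroup.center G : Set G) = 4 := hz
        omega
    have h2 : d * x ∈ {w : G | IsConj x w} := by
      rw [h1]
      exact ⟨d, hdZ, rfl⟩
    obtain ⟨g, hg⟩ := isConj_iff.mp h2
    refine ⟨g, ?_⟩
    rw [commutator_comm_of_sq_mem hsq, commutatorElement_def, hg, mul_inv_cancel_right]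
  have hF : ∀ p q : G, p ∉ Subgroup.center G → ⁅p, q⁆ = 1 → ⁅x, q⁆ = 1 ∨ ⁅x, q⁆ = ⁅x, p⁆ := by
    intro p q hp hpq
    by_cases hq : q ∈ Subgroup.center G
    · exact Or.inl (commutator_of_mem_center hq x)
    · right
      have h1 := mul_mem_center_of_commute (hC' p hp) hp
        (commutatorElement_eq_one_iff_commute.mp hpq).symm hq
      have h2 := commutator_of_mem_center h1 x
      rw [hR, ← commutator_comm_of_sq_mem hsq p x, ← commutatorElement_inv, inv_mul_eq_one] at h2
      exact h2.symm
  have hdd : d * d = 1 := by rw [← hu, ← pow_two, commutator_sq_of_sq_mem hsq]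
  have hxyx : ⁅x, x * y⁆ = c := by rw [hR, commutatorElement_self, one_mul]
  have hxyZ : x * y ∉ Subgroup.center G := fun h => hc1 (by
    rw [← hxyx, commutator_of_mem_center h])
  have hcd : c * d = d * c := Subgroup.mem_center_iff.mp hdZ c
  -- For [y, u] equal to 1, c, d or cd, the commuting pair is (y, u), (y, ux), (xy, u) or (xy, uy);
  -- each contradicts `hF`.
  rcases mem_center_cases hz (hcen x y) hdZ hc1 hd1 hdc (by rw [pow_two, hcc]) (hcen y u) with
    he | he | he | he
  · rcases hF y u hyZ he with h | h
    · exact hd1 (hu ▸ h)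
    · exact hdc (hu ▸ h)
  · have h1 : ⁅y, u * x⁆ = 1 := by
      rw [hR, he, commutator_comm_of_sq_mem hsq y x]
      exact hcc
    have h2 : ⁅x, u * x⁆ = d := by rw [hR, hu, commutatorElement_self, mul_one]
    rcases hF y _ hyZ h1 with h | h
    · exact hd1 (h2 ▸ h)
    · exact hdc (h2 ▸ h)
  · have h1 : ⁅x * y, u⁆ = 1 := by rw [hL, hu, he, hdd]
    rcases hF _ u hxyZ h1 with h | h
    · exact hd1 (hu ▸ h)
    · rw [hxyx, hu] at h
      exact hdc h
  · have h1 : ⁅x * y, u * y⁆ = 1 := by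
      rw [hL, hR, hR, hu, he, commutatorElement_self, mul_one, ← hc, mul_assoc, ← mul_assoc c,
        hcc, one_mul, hdd]
    have h2 : ⁅x, u * y⁆ = d * c := by rw [hR, hu]
    rcases hF _ _ hxyZ h1 with h | h
    · rw [h2] at h
      apply hdc
      rw [← mul_left_inj c, h, hcc]
    · rw [h2, hxyx] at h
      exact hd1 (mul_eq_right.mp h)

/-- In the chain Z < H ∩ C(x) < H both inclusions are strict, so |H| ≥ 16. -/
theorem eq_top_of_card_sixteen {G : Type*} [Group G] [Finite G] (hG : Nat.card G = 16)
    (hz : Nat.card (Subgroup.center G) = 4)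
    {H : Subgroup G} (hH : Subgroup.center G ≤ H) {x y : G} (hx : x ∈ H) (hy : y ∈ H)
    (hxy : ⁅x, y⁆ ≠ 1) : H = ⊤ := by
  have hxy' : ¬ x * y = y * x := fun h => hxy (commutatorElement_eq_one_iff_commute.mpr h)
  have hxZ : x ∉ Subgroup.center G := fun h => hxy' (Subgroup.mem_center_iff.mp h y).symm
  set K := H ⊓ Subgroup.centralizer {x} with hK
  have hZK : Subgroup.center G ≤ K := le_inf hH (Subgroup.center_le_centralizer _)
  have h1 : Nat.card K ≠ 4 := by
    intro h
    have := Subgroup.eq_of_le_of_card_ge hZK (by rw [h, hz])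
    exact hxZ (this ▸ ⟨hx, mem_centralizer_singleton.mpr rfl⟩)
  have h2 := Subgroup.card_dvd_of_le hZK
  have h3 : Nat.card H ≠ Nat.card K := by
    intro h
    have : K = H := Subgroup.eq_of_le_of_card_ge inf_le_left h.le
    rw [← this] at hy
    exact hxy' (mem_centralizer_singleton.mp hy.2).symm
  have h4 : Nat.card K ∣ Nat.card H := Subgroup.card_dvd_of_le inf_le_left
  have h5 := Subgroup.card_subgroup_dvd_card H
  have h6 : 0 < Nat.card K := Nat.card_pos
  have h7 : 0 < Nat.card H := Nat.card_pos
  rw [hz] at h2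
  rw [hG] at h5
  have h8 := Nat.le_of_dvd (by norm_num) h5
  apply Subgroup.eq_top_of_card_eq
  rw [hG]
  obtain ⟨m, hm⟩ := h4
  rcases m with - | - | m
  · omega
  · omega
  · have h9 : Nat.card K * 2 ≤ Nat.card K * (m + 1 + 1) := Nat.mul_le_mul_left _ (by omega)
    omega

/-- The homomorphism from `C₄ × C₂` determined by two commuting elements. -/
def prodLift {G : Type*} [Group G] (a b : G) (ha : a ^ 4 = 1) (hb : b ^ 2 = 1)
    (hab : Commute a b) : Cyc 4 × Cyc 2 →* G :=
  MonoidHom.noncommCoprod (cycHom 4 a ha) (cycHom 2 b hb) fun _ _ => hab.pow_pow _ _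

theorem prodLift_left {G : Type*} [Group G] (a b : G) (ha : a ^ 4 = 1) (hb : b ^ 2 = 1)
    (hab : Commute a b) : prodLift a b ha hb hab (.ofAdd 1, 1) = a := by
  change cycHom 4 a ha (.ofAdd 1) * cycHom 2 b hb 1 = a
  rw [map_one (cycHom 2 b hb), mul_one, cycHom_ofAdd_one]

theorem prodLift_right {G : Type*} [Group G] (a b : G) (ha : a ^ 4 = 1) (hb : b ^ 2 = 1)
    (hab : Commute a b) : prodLift a b ha hb hab (1, .ofAdd 1) = b := by
  change cycHom 4 a ha 1 * cycHom 2 b hb (.ofAdd 1) = b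
  rw [map_one (cycHom 4 a ha), one_mul, cycHom_ofAdd_one]

theorem prod_cyc_hom_ext {G : Type*} [Group G] {f g : Cyc 4 × Cyc 2 →* G}
    (h1 : f (.ofAdd 1, 1) = g (.ofAdd 1, 1)) (h2 : f (1, .ofAdd 1) = g (1, .ofAdd 1)) : f = g := by
  have hp : ∀ p : Cyc 4 × Cyc 2, p = (.ofAdd 1, 1) ^ (Multiplicative.toAdd p.1).val *
      (1, .ofAdd 1) ^ (Multiplicative.toAdd p.2).val := by decide
  refine MonoidHom.ext fun p => ?_
  rw [hp p, map_mul, map_mul, map_pow, map_pow, map_pow, map_pow, h1, h2]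

theorem hom_comp_aut_eq_conj {G : Type*} [Group G] {f : MulAut (Cyc 4 × Cyc 2)}
    {φ : Cyc 4 × Cyc 2 →* G} {t : G} (h1 : φ (f (.ofAdd 1, 1)) = t * φ (.ofAdd 1, 1) * t⁻¹)
    (h2 : φ (f (1, .ofAdd 1)) = t * φ (1, .ofAdd 1) * t⁻¹) (p : Cyc 4 × Cyc 2) :
    φ (f p) = t * φ p * t⁻¹ :=
  DFunLike.congr_fun (prod_cyc_hom_ext (f := φ.comp f.toMonoidHom)
    (g := (MulAut.conj t).toMonoidHom.comp φ) h1 h2) p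

/-- Through `htop`, surjectivity of the lift only requires its range to contain the centre and the
noncommuting pair; the other recognition lemmas use the same device. -/
theorem nonempty_mulEquiv_C8sdC2 {G : Type*} [Group G] (hG : Nat.card G = 16)
    (htop : ∀ (H : Subgroup G) (x y : G), Subgroup.center G ≤ H → x ∈ H → y ∈ H → ⁅x, y⁆ ≠ 1 →
      H = ⊤)
    {u v : G} (hu : u ^ 8 = 1) (hv : v ^ 2 = 1)
    (hvu : v * u * v⁻¹ = u ^ 5) (huv : ⁅u, v⁆ ≠ 1)
    (hZ : ∀ z ∈ Subgroup.center G, z ∈ Subgroup.zpowers (u ^ 2)) : Nonempty (G ≃* C8sdC2) := by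
  have hφ : ∀ x : Cyc 8, cycHom 8 u hu (powFiveAut x) = v * cycHom 8 u hu x * v⁻¹ := by
    intro x
    change cycHom 8 u hu (x ^ 5) = v * u ^ _ * v⁻¹
    rw [conj_pow_of_conj hvu, map_pow, ← pow_mul, mul_comm, pow_mul]
    rfl
  obtain ⟨h1, h2⟩ := mem_range_cyclicLift (hf := powFiveAut_sq) (cycHom 8 u hu) v hv hφ
  have h1 := h1 (.ofAdd 1)
  rw [cycHom_ofAdd_one] at h1
  refine nonempty_mulEquiv_of_range_eq_top _ (htop _ u v (fun z hz => ?_) h1 h2 huv) ?_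
  · exact (Subgroup.zpowers_le.mpr (Subgroup.pow_mem _ h1 2)) (hZ z hz)
  · rw [SemidirectProduct.card, hG]
    simp

theorem nonempty_mulEquiv_twist {G : Type*} [Group G] (hG : Nat.card G = 16)
    (htop : ∀ (H : Subgroup G) (x y : G), Subgroup.center G ≤ H → x ∈ H → y ∈ H → ⁅x, y⁆ ≠ 1 →
      H = ⊤)
    {z x y : G} (hz : z ^ 4 = 1) (hzZ : z ∈ Subgroup.center G)
    (hx : x ^ 2 = 1) (hy : y ^ 2 = 1) (hyx : y * x * y⁻¹ = z ^ 2 * x) (hxy : ⁅x, y⁆ ≠ 1)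
    (hZ : ∀ w ∈ Subgroup.center G, w ∈ Subgroup.zpowers z) : Nonempty (G ≃* C4C2sdC2twist) := by
  have hzx : Commute z x := (Subgroup.mem_center_iff.mp hzZ x).symm
  have hφ := hom_comp_aut_eq_conj (f := twistAut) (φ := prodLift z x hz hx hzx) (t := y)
    (by
      rw [show twistAut (.ofAdd 1, 1) = (.ofAdd 1, 1) by decide, prodLift_left,
        Subgroup.mem_center_iff.mp hzZ y, mul_inv_cancel_right])
    (by
      rw [show twistAut (1, .ofAdd 1) = (.ofAdd 1, 1) ^ 2 * (1, .ofAdd 1) by decide, map_mul,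
        map_pow, prodLift_left, prodLift_right, hyx])
  obtain ⟨h1, h2⟩ := mem_range_cyclicLift (hf := twistAut_sq) _ y hy hφ
  have h3 := h1 (.ofAdd 1, 1)
  have h4 := h1 (1, .ofAdd 1)
  rw [prodLift_left] at h3
  rw [prodLift_right] at h4
  refine nonempty_mulEquiv_of_range_eq_top _ (htop _ x y (fun w hw => ?_) h4 h2 hxy) ?_
  · exact (Subgroup.zpowers_le.mpr h3) (hZ w hw)
  · rw [SemidirectProduct.card, hG]
    simp

theorem nonempty_mulEquiv_shear {G : Type*} [Group G] (hG : Nat.card G = 16)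
    (htop : ∀ (H : Subgroup G) (x y : G), Subgroup.center G ≤ H → x ∈ H → y ∈ H → ⁅x, y⁆ ≠ 1 →
      H = ⊤)
    {c x y : G} (hc : c ^ 2 = 1) (hcZ : c ∈ Subgroup.center G)
    (hy : y ^ 4 = 1) (hx : x ^ 2 = 1) (hxy : x * y * x⁻¹ = c * y) (hxy1 : ⁅x, y⁆ ≠ 1)
    (hZ : ∀ H : Subgroup G, c ∈ H → y ^ 2 ∈ H → Subgroup.center G ≤ H) :
    Nonempty (G ≃* C4C2sdC2shear) := by
  have hyc : Commute y c := Subgroup.mem_center_iff.mp hcZ y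
  have hφ := hom_comp_aut_eq_conj (f := shearAut) (φ := prodLift y c hy hc hyc) (t := x)
    (by
      rw [show shearAut (.ofAdd 1, 1) = (1, .ofAdd 1) * (.ofAdd 1, 1) by decide, map_mul,
        prodLift_left, prodLift_right, hxy])
    (by
      rw [show shearAut (1, .ofAdd 1) = (1, .ofAdd 1) by decide, prodLift_right,
        Subgroup.mem_center_iff.mp hcZ x, mul_inv_cancel_right])
  obtain ⟨h1, h2⟩ := mem_range_cyclicLift (hf := shearAut_sq) _ x hx hφ
  have h3 := h1 (.ofAdd 1, 1)
  have h4 := h1 (1, .ofAdd 1)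
  rw [prodLift_left] at h3
  rw [prodLift_right] at h4
  refine nonempty_mulEquiv_of_range_eq_top _
    (htop _ x y (hZ _ h4 (Subgroup.pow_mem _ h3 2)) h2 h3 hxy1) ?_
  rw [SemidirectProduct.card, hG]
  simp

theorem nonempty_mulEquiv_C4sdC4 {G : Type*} [Group G] (hG : Nat.card G = 16)
    (htop : ∀ (H : Subgroup G) (x y : G), Subgroup.center G ≤ H → x ∈ H → y ∈ H → ⁅x, y⁆ ≠ 1 →
      H = ⊤)
    {x y : G} (hx : x ^ 4 = 1) (hy : y ^ 4 = 1)
    (hyx : y * x * y⁻¹ = x⁻¹) (hxy1 : ⁅x, y⁆ ≠ 1)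
    (hZ : ∀ H : Subgroup G, x ^ 2 ∈ H → y ^ 2 ∈ H → Subgroup.center G ≤ H) :
    Nonempty (G ≃* C4sdC4) := by
  have hφ : ∀ g : Cyc 4, cycHom 4 x hx (invAut 4 g) = y * cycHom 4 x hx g * y⁻¹ := by
    intro g
    change cycHom 4 x hx g⁻¹ = y * x ^ _ * y⁻¹
    rw [conj_pow_of_conj hyx, map_inv, inv_pow]
    rfl
  obtain ⟨h1, h2⟩ := mem_range_cyclicLift (hf := invAut_pow_four 4) (cycHom 4 x hx) y hy hφ
  have h1 := h1 (.ofAdd 1)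
  rw [cycHom_ofAdd_one] at h1
  refine nonempty_mulEquiv_of_range_eq_top _
    (htop _ x y (hZ _ (Subgroup.pow_mem _ h1 2) (Subgroup.pow_mem _ h2 2)) h1 h2 hxy1) ?_
  rw [SemidirectProduct.card, hG]
  simp

theorem nonempty_mulEquiv_prod_cyc_two {G : Type*} [Group G] (hG : Nat.card G = 16)
    (htop : ∀ (H : Subgroup G) (x y : G), Subgroup.center G ≤ H → x ∈ H → y ∈ H → ⁅x, y⁆ ≠ 1 →
      H = ⊤)
    {K : Type*} [Group K] [Finite K] (hK : Nat.card K = 8)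
    {d x y : G} (f : K →* G) (hd : d ^ 2 = 1) (hdZ : d ∈ Subgroup.center G)
    (hx : x ∈ f.range) (hy : y ∈ f.range) (hxy1 : ⁅x, y⁆ ≠ 1)
    (hZ : ∀ H : Subgroup G, x ^ 2 ∈ H → d ∈ H → Subgroup.center G ≤ H) :
    Nonempty (G ≃* (K × Cyc 2)) := by
  have hcomm : ∀ (k : K) (i : Cyc 2), Commute (f k) (cycHom 2 d hd i) := fun k i =>
    Commute.pow_right (Subgroup.mem_center_iff.mp hdZ (f k)) _
  set F := MonoidHom.noncommCoprod f (cycHom 2 d hd) hcomm with hF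
  have h1 : ∀ g ∈ f.range, g ∈ F.range := by
    rintro _ ⟨k, rfl⟩
    exact ⟨(k, 1), by simp [hF, MonoidHom.noncommCoprod_apply]⟩
  have h2 : d ∈ F.range :=
    ⟨(1, .ofAdd 1), by simp [hF, MonoidHom.noncommCoprod_apply, cycHom_ofAdd_one]⟩
  refine nonempty_mulEquiv_of_range_eq_top F
    (htop _ x y (hZ _ (Subgroup.pow_mem _ (h1 x hx) 2) h2) (h1 x hx) (h1 y hy) hxy1) ?_
  rw [Nat.card_prod, hK, hG]
  simp


/-- The groups of order sixteen with cyclic centre of order four. -/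
theorem card_sixteen_of_cyclic_center {G : Type*} [Group G] [Finite G]
    (hn : ∃ a b : G, a * b ≠ b * a) (hG : Nat.card G = 16)
    (htop : ∀ (H : Subgroup G) (x y : G), Subgroup.center G ≤ H → x ∈ H → y ∈ H → ⁅x, y⁆ ≠ 1 →
      H = ⊤)
    (hz : Nat.card (Subgroup.center G) = 4) (hsq : ∀ x : G, x ^ 2 ∈ Subgroup.center G)
    (hcyc : ∃ z ∈ Subgroup.center G, z ^ 2 ≠ 1) :
    Nonempty (G ≃* C8sdC2) ∨ Nonempty (G ≃* C4C2sdC2twist) := by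
  have hcen := commutator_mem_center_of_sq_mem hsq
  have hR := commutator_mul_right_of_central hcen
  have hL := commutator_mul_left_of_central hcen
  have hsymm := commutator_comm_of_sq_mem hsq
  have hgen : ∀ z ∈ Subgroup.center G, z ^ 2 ≠ 1 →
      orderOf z = 4 ∧ Subgroup.zpowers z = Subgroup.center G := by
    intro z hzZ hz2
    have h1 : z ^ 4 = 1 := by
      rw [← orderOf_dvd_iff_pow_eq_one, ← hz]
      exact dvd_card_of_mem hzZ rfl
    have h2 : orderOf z = 4 := orderOf_eq_prime_pow (p := 2) (n := 1) (by simpa using hz2) h1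
    exact ⟨h2, Subgroup.eq_of_le_of_card_ge (by simpa using hzZ)
      (by rw [Nat.card_zpowers, h2, hz])⟩
  have hcases : ∀ z ∈ Subgroup.center G, z ^ 2 ≠ 1 → ∀ w ∈ Subgroup.center G,
      w = 1 ∨ w = z ∨ w = z ^ 2 ∨ w = z ^ 3 := by
    intro z hzZ hz2 w hw
    obtain ⟨h1, h2⟩ := hgen z hzZ hz2
    rw [← h2] at hw
    obtain ⟨k, hk, rfl⟩ := exists_pow_lt_of_mem_zpowers hw
    rw [h1] at hk
    interval_cases k <;> simp
  have hz4 : ∀ z ∈ Subgroup.center G, z ^ 2 ≠ 1 → z ^ 4 = 1 := by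
    intro z hzZ hz2
    rw [← (hgen z hzZ hz2).1, pow_orderOf_eq_one]
  -- A nontrivial commutator squares to 1, so it is the unique involution of the cyclic centre.
  have hcz : ∀ z ∈ Subgroup.center G, z ^ 2 ≠ 1 → ∀ x y : G, ⁅x, y⁆ ≠ 1 → ⁅x, y⁆ = z ^ 2 := by
    intro z hzZ hz2 x y hxy
    have h1 := commutator_sq_of_sq_mem hsq x y
    have h4 := hz4 z hzZ hz2
    rcases hcases z hzZ hz2 _ (hcen x y) with h | h | h | h
    · exact (hxy h).elim
    · rw [h] at h1
      exact (hz2 h1).elim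
    · exact h
    · rw [h, ← pow_mul, show 3 * 2 = 4 + 2 by norm_num, pow_add, h4, one_mul] at h1
      exact (hz2 h1).elim
  obtain ⟨x, y, hxy'⟩ := hn
  have hxy : ⁅x, y⁆ ≠ 1 := fun h => hxy' (commutatorElement_eq_one_iff_commute.mp h).eq
  by_cases hu : ∃ u : G, u ∉ Subgroup.center G ∧ (u ^ 2) ^ 2 ≠ 1
  · left
    obtain ⟨u, huZ, hu⟩ := hu
    have hu8 : u ^ 8 = 1 := by
      have := hz4 _ (hsq u) hu
      rwa [← pow_mul] at this
    obtain ⟨v, hv⟩ : ∃ v : G, ⁅u, v⁆ ≠ 1 := by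
      by_contra! hall
      exact huZ (Subgroup.mem_center_iff.mpr fun g =>
        (commutatorElement_eq_one_iff_commute.mp (hall g)).eq.symm)
    have hcu := hcz _ (hsq u) hu u v hv
    -- Multiplying `v` by powers of `u` keeps the commutator with `u` and changes the square; one of
    -- `v`, `u * v`, `v * u ^ 2`, `u * v * u ^ 2` squares to 1.
    obtain ⟨w, hw, hw2⟩ : ∃ w : G, ⁅u, w⁆ = (u ^ 2) ^ 2 ∧ w ^ 2 = 1 := by
      have hcu2 : ⁅u, u ^ 2⁆ = 1 := commutator_of_mem_center (hsq u) u
      have hv2 : Commute v (u ^ 2) := Subgroup.mem_center_iff.mp (hsq u) v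
      rcases hcases _ (hsq u) hu _ (hsq v) with h | h | h | h
      · exact ⟨v, hcu, h⟩
      · refine ⟨u * v, by rw [hR, commutatorElement_self, one_mul, hcu], ?_⟩
        rw [mul_sq_of_sq_mem hsq, hcu, h, ← pow_mul, ← pow_add, ← pow_add, hu8]
      · refine ⟨v * u ^ 2, by rw [hR, hcu2, mul_one, hcu], ?_⟩
        rw [hv2.mul_pow, h, ← pow_mul, ← pow_add, hu8]
      · refine ⟨u * v * u ^ 2, by
          rw [hR, hR, commutatorElement_self, one_mul, hcu, hcu2, mul_one], ?_⟩
        have h1 : Commute (u * v) (u ^ 2) := Subgroup.mem_center_iff.mp (hsq u) _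
        rw [h1.mul_pow, mul_sq_of_sq_mem hsq, hcu, h, ← pow_mul, ← pow_mul, ← pow_add, ← pow_add,
          ← pow_add, show 2 * 2 + 2 + 2 * 3 + 2 * 2 = 8 * 2 by norm_num, pow_mul, hu8, one_pow]
    refine nonempty_mulEquiv_C8sdC2 hG htop hu8 hw2 ?_ ?_ ?_ (u := u) (v := w)
    · rw [conj_eq_commutator_mul, ← hsymm, hw, ← pow_mul, ← pow_succ]
    · rwa [hw]
    · intro z hz
      rwa [(hgen _ (hsq u) hu).2]
  · right
    push Not at hu
    obtain ⟨z, hzZ, hz2⟩ := hcyc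
    -- Here `u ^ 2` is 1 or `z ^ 2`, and in the second case the central factor `z` cancels it.
    have hadj : ∀ u : G, u ∉ Subgroup.center G → ∃ w ∈ Subgroup.center G, (u * w) ^ 2 = 1 := by
      intro u huZ
      have h1 := hu u huZ
      rcases hcases z hzZ hz2 _ (hsq u) with h | h | h | h
      · exact ⟨1, Subgroup.one_mem _, by rwa [mul_one]⟩
      · rw [h] at h1
        exact (hz2 h1).elim
      · refine ⟨z, hzZ, ?_⟩
        have h2 : Commute u z := Subgroup.mem_center_iff.mp hzZ u
        rw [h2.mul_pow, h, ← pow_add, hz4 z hzZ hz2]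
      · rw [h, ← pow_mul, show 3 * 2 = 4 + 2 by norm_num, pow_add, hz4 z hzZ hz2, one_mul] at h1
        exact (hz2 h1).elim
    obtain ⟨w₁, hw₁, h1⟩ := hadj x fun h => hxy (by
      rw [hsymm, commutator_of_mem_center h])
    obtain ⟨w₂, hw₂, h2⟩ := hadj y fun h => hxy (commutator_of_mem_center h x)
    have h3 : ⁅x * w₁, y * w₂⁆ = z ^ 2 := by
      rw [hR, commutator_of_mem_center hw₂, mul_one, hL, hsymm w₁, commutator_of_mem_center hw₁,
        mul_one, hcz z hzZ hz2 x y hxy]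
    refine nonempty_mulEquiv_twist hG htop (hz4 z hzZ hz2) hzZ h1 h2 ?_ ?_ ?_
    · rw [conj_eq_commutator_mul, hsymm, h3]
    · rwa [h3]
    · intro w hw
      rwa [(hgen z hzZ hz2).2]

/-- The groups of order sixteen with elementary abelian centre of order four. -/
theorem card_sixteen_of_elementary_center {G : Type*} [Group G] [Finite G]
    (hn : ∃ a b : G, a * b ≠ b * a) (hG : Nat.card G = 16)
    (htop : ∀ (H : Subgroup G) (x y : G), Subgroup.center G ≤ H → x ∈ H → y ∈ H → ⁅x, y⁆ ≠ 1 →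
      H = ⊤)
    (hz : Nat.card (Subgroup.center G) = 4) (hsq : ∀ x : G, x ^ 2 ∈ Subgroup.center G)
    (hel : ∀ z ∈ Subgroup.center G, z ^ 2 = 1) :
    Nonempty (G ≃* C4C2sdC2shear) ∨ Nonempty (G ≃* C4sdC4) ∨
      Nonempty (G ≃* (DihedralGroup 4 × Cyc 2)) ∨
      Nonempty (G ≃* (QuaternionGroup 2 × Cyc 2)) := by
  have hcen := commutator_mem_center_of_sq_mem hsq
  have hR := commutator_mul_right_of_central hcen
  have hL := commutator_mul_left_of_central hcen
  have hsymm := commutator_comm_of_sq_mem hsq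
  have hmul := mul_sq_of_sq_mem hsq
  have hp4 : ∀ x : G, x ^ 4 = 1 := fun x => by
    rw [show 4 = 2 * 2 by norm_num, pow_mul, hel _ (hsq x)]
  have hle : ∀ c d : G, c ∈ Subgroup.center G → d ∈ Subgroup.center G → c ≠ 1 → d ≠ 1 → d ≠ c →
      ∀ H : Subgroup G, c ∈ H → d ∈ H → Subgroup.center G ≤ H := by
    intro c d hc hd hc1 hd1 hdc H hcH hdH z hzZ
    rcases mem_center_cases hz hc hd hc1 hd1 hdc (hel c hc) hzZ with rfl | rfl | rfl | rfl
    · exact H.one_mem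
    · exact hcH
    · exact hdH
    · exact H.mul_mem hcH hdH
  -- The dichotomy is whether some noncommuting pair has a square which together with the commutator
  -- generates the centre.
  by_cases hB : ∃ y v : G, ⁅v, y⁆ ≠ 1 ∧ y ^ 2 ≠ 1 ∧ y ^ 2 ≠ ⁅v, y⁆
  · obtain ⟨y, v, hc1, hd1, hdc⟩ := hB
    -- Since (vy)² = [v, y] v² y², replacing `v` by `v * y` removes the component of `y ^ 2` from
    -- the square.
    obtain ⟨x, hxy, hx2⟩ : ∃ x : G, ⁅x, y⁆ = ⁅v, y⁆ ∧ (x ^ 2 = 1 ∨ x ^ 2 = ⁅v, y⁆) := by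
      have hvy : ⁅v * y, y⁆ = ⁅v, y⁆ := by rw [hL, commutatorElement_self, mul_one]
      have hyy : y ^ 2 * y ^ 2 = 1 := by rw [← pow_two, hel _ (hsq y)]
      have hcc : ⁅v, y⁆ * ⁅v, y⁆ = 1 := by rw [← pow_two, hel _ (hcen v y)]
      rcases mem_center_cases hz (hcen v y) (hsq y) hc1 hd1 hdc (hel _ (hcen v y)) (hsq v) with
        h | h | h | h
      · exact ⟨v, rfl, Or.inl h⟩
      · exact ⟨v, rfl, Or.inr h⟩
      · exact ⟨v * y, hvy, Or.inr (by rw [hmul, h, mul_assoc, hyy, mul_one])⟩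
      · exact ⟨v * y, hvy, Or.inl (by rw [hmul, h, ← mul_assoc, hcc, one_mul, hyy])⟩
    rw [← hxy] at hc1 hdc hx2
    rcases hx2 with hx2 | hx2
    · left
      exact nonempty_mulEquiv_shear hG htop (hel _ (hcen x y)) (hcen x y) (hp4 y) hx2
        (conj_eq_commutator_mul x y) hc1 (hle _ _ (hcen x y) (hsq y) hc1 hd1 hdc)
    · right; left
      refine nonempty_mulEquiv_C4sdC4 hG htop (hp4 x) (hp4 y) ?_ hc1
        (hle _ _ (hsq x) (hsq y) (by rwa [hx2]) hd1 (by rwa [hx2]))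
      rw [conj_eq_commutator_mul, hsymm, ← hx2, eq_inv_iff_mul_eq_one, ← pow_succ, ← pow_succ, hp4]
  · right; right
    push Not at hB
    obtain ⟨x, y, hxy'⟩ := hn
    have hxy : ⁅x, y⁆ ≠ 1 := fun h => hxy' (commutatorElement_eq_one_iff_commute.mp h).eq
    obtain ⟨d, hdZ, hd1, hdc⟩ : ∃ d ∈ Subgroup.center G, d ≠ 1 ∧ d ≠ ⁅x, y⁆ :=
      exists_mem_center_ne hz _
    have hD : ∀ r s : G, ⁅r, s⁆ = ⁅x, y⁆ → r ^ 2 = ⁅x, y⁆ → s ^ 2 = 1 →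
        Nonempty (G ≃* (DihedralGroup 4 × Cyc 2)) := by
      intro r s hrs hr hs
      have hconj : s * r * s⁻¹ = r⁻¹ := by
        rw [conj_eq_commutator_mul, hsymm, hrs, ← hr, eq_inv_iff_mul_eq_one, ← pow_succ,
          ← pow_succ, hp4]
      obtain ⟨h1, h2⟩ := mem_range_dihedralLift 4 r s (hp4 r) hs hconj
      refine nonempty_mulEquiv_prod_cyc_two hG htop (by rw [DihedralGroup.nat_card]) _
        (hel d hdZ) hdZ h1 h2 (by rwa [hrs]) ?_
      rw [hr]
      exact hle _ _ (hcen x y) hdZ hxy hd1 hdc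
    have hyx2 : y ^ 2 = 1 ∨ y ^ 2 = ⁅x, y⁆ := by
      by_cases h : y ^ 2 = 1
      · exact Or.inl h
      · exact Or.inr (hB y x hxy h)
    have hxx2 : x ^ 2 = 1 ∨ x ^ 2 = ⁅x, y⁆ := by
      by_cases h : x ^ 2 = 1
      · exact Or.inl h
      · exact Or.inr ((hB x y (by rwa [hsymm]) h).trans (hsymm y x))
    rcases hxx2 with hx | hx <;> rcases hyx2 with hy | hy
    · left
      -- If `x` and `y` both square to 1, then `x * y` squares to the commutator and serves as the
      -- rotation of order four.
      refine hD (x * y) y ?_ ?_ hy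
      · rw [hL, commutatorElement_self, mul_one]
      · rw [hmul, hx, hy, mul_one, mul_one]
    · left
      exact hD y x (hsymm y x) hy hx
    · left
      exact hD x y rfl hx hy
    · right
      have hconj : y * x * y⁻¹ = x⁻¹ := by
        rw [conj_eq_commutator_mul, hsymm, ← hx, eq_inv_iff_mul_eq_one, ← pow_succ,
          ← pow_succ, hp4]
      obtain ⟨h1, h2⟩ := mem_range_quaternionLift 2 x y (hp4 x) (by rw [hx, hy]) hconj
      refine nonempty_mulEquiv_prod_cyc_two hG htop
        (by rw [Nat.card_eq_fintype_card, QuaternionGroup.card]) _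
        (hel d hdZ) hdZ h1 h2 hxy ?_
      rw [hx]
      exact hle _ _ (hcen x y) hdZ hxy hd1 hdc

/-- The case of a centre of order four. -/
theorem SmallCentralizers.of_card_center_eq_four {G : Type*} [Group G] [Finite G]
    (hn : ∃ a b : G, a * b ≠ b * a) (h : SmallCentralizers G)
    (hz : Nat.card (Subgroup.center G) = 4) :
    (Nonempty (G ≃* C8sdC2) ∨ Nonempty (G ≃* C4C2sdC2twist)) ∨
      Nonempty (G ≃* C4C2sdC2shear) ∨ Nonempty (G ≃* C4sdC4) ∨
      Nonempty (G ≃* (DihedralGroup 4 × Cyc 2)) ∨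
      Nonempty (G ≃* (QuaternionGroup 2 × Cyc 2)) := by
  have hmem : ∀ x : G, x ∉ Subgroup.center G →
      Nat.card (Subgroup.centralizer {x}) ∈ ({8} : Finset ℕ) := by
    intro x hx
    rcases h.card_cases hx with h | h | h | h
    · omega
    · omega
    · omega
    · exact h.2
  have hC : ∀ x : G, x ∉ Subgroup.center G → Nat.card (Subgroup.centralizer {x}) = 8 :=
    fun x hx => Finset.mem_singleton.mp (hmem x hx)
  have hsq := sq_mem_center_of_card_centralizer fun x hx => (hC x hx).trans (by rw [hz])
  rcases card_eq_of_card_center_eq_four hn hmem hz with hG | hG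
  · have htop : ∀ (H : Subgroup G) (x y : G), Subgroup.center G ≤ H → x ∈ H → y ∈ H →
        ⁅x, y⁆ ≠ 1 → H = ⊤ := fun H x y h1 h2 h3 h4 =>
      eq_top_of_card_sixteen hG hz h1 h2 h3 h4
    by_cases hcyc : ∃ z ∈ Subgroup.center G, z ^ 2 ≠ 1
    · exact Or.inl (card_sixteen_of_cyclic_center hn hG htop hz hsq hcyc)
    · push Not at hcyc
      exact Or.inr (card_sixteen_of_elementary_center hn hG htop hz hsq hcyc)
  · exact (not_card_eq_thirtyTwo hn hG hz hC).elim

end CommutatorCalculus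

/-! ### The classification -/

/-- `DihedralGroup n` has order `2 * n` and `QuaternionGroup 2` has order `8`. -/
theorem corollary1p2 (G : Type*) [Group G] :
    (Finite G ∧ (∃ a b : G, a * b ≠ b * a) ∧ StrongStarFree 4 G) ↔
      (Nonempty (G ≃* Equiv.Perm (Fin 3)) ∨
        Nonempty (G ≃* alternatingGroup (Fin 4)) ∨
        Nonempty (G ≃* alternatingGroup (Fin 5)) ∨
        Nonempty (G ≃* DihedralGroup 4) ∨
        Nonempty (G ≃* DihedralGroup 5) ∨
        Nonempty (G ≃* GA15) ∨
        Nonempty (G ≃* QuaternionGroup 2) ∨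
        Nonempty (G ≃* DihedralGroup 6) ∨
        Nonempty (G ≃* C3sdC4) ∨
        Nonempty (G ≃* Matrix.SpecialLinearGroup (Fin 2) (ZMod 3)) ∨
        Nonempty (G ≃* C4C2sdC2shear) ∨
        Nonempty (G ≃* C4sdC4) ∨
        Nonempty (G ≃* C8sdC2) ∨
        Nonempty (G ≃* (DihedralGroup 4 × Cyc 2)) ∨
        Nonempty (G ≃* (QuaternionGroup 2 × Cyc 2)) ∨
        Nonempty (G ≃* C4C2sdC2twist)) := by
  constructor
  · rintro ⟨hfin, hn, hstar⟩
    have h := strongStarFree_four_iff.mp hstar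
    obtain ⟨x, hx⟩ := exists_notMem_center hn
    rcases h.card_cases hx with ⟨hz, -⟩ | ⟨hz, -⟩ | ⟨hz, -⟩ | ⟨hz, -⟩
    · have := h.of_card_center_eq_one hn hz
      tauto
    · have := h.of_card_center_eq_two hn hz
      tauto
    · refine (card_center_ne_three hn (fun y hy => ?_) hz).elim
      rcases h.card_cases hy with h | h | h | h
      · omega
      · omega
      · exact h.2
      · omega
    · have := h.of_card_center_eq_four hn hz
      tauto
  · rintro (h | h | h | h | h | h | h | h | h | h | h | h | h | h | h | h)
    · exact isFiniteNonabelianStarFree_perm_three.congr h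
    · exact isFiniteNonabelianStarFree_alternatingGroup_four.congr h
    · exact isFiniteNonabelianStarFree_alternatingGroup_five.congr h
    · exact isFiniteNonabelianStarFree_dihedral_four.congr h
    · exact isFiniteNonabelianStarFree_dihedral_five.congr h
    · exact isFiniteNonabelianStarFree_GA15.congr h
    · exact isFiniteNonabelianStarFree_quaternion.congr h
    · exact isFiniteNonabelianStarFree_dihedral_six.congr h
    · exact isFiniteNonabelianStarFree_C3sdC4.congr h
    · exact isFiniteNonabelianStarFree_specialLinearGroup.congr h
    · exact isFiniteNonabelianStarFree_shear.congr h
    · exact isFiniteNonabelianStarFree_C4sdC4.congr h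
    · exact isFiniteNonabelianStarFree_C8sdC2.congr h
    · exact isFiniteNonabelianStarFree_dihedral_four_prod.congr h
    · exact isFiniteNonabelianStarFree_quaternion_prod.congr h
    · exact isFiniteNonabelianStarFree_twist.congr h
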